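/- Let $T>0$, let $(\Omega,\mathcal G,P)$ be a probability space and let $W=(W_t)_{t\ge 0}$ be a standard $d$-dimensional Brownian motion on it (started at $0$). For $s\in\mathbb R$ and $1\le r<\infty$ let $H^s_r(\mathbb R^d)$ be the space of real tempered distributions $u$ on $\mathbb R^d$ with $(I-\frac12\Delta)^{s/2}u\in L^r(\mathbb R^d)$ (the power being defined by Fourier transform), with norm $\|u\|_{H^s_r}=\|(I-\frac12\Delta)^{s/2}u\|_{L^r}$; $H^s_r$ denotes the space of $\mathbb R^d$-valued distributions with all $d$ components in $H^s_r(\mathbb R^d)$, and $C([0,T];H^s_r)$ carries the sup norm. Let $\mathcal C$ be the space of continuous $\mathbb R^d$-valued processes indexed by $[0,T]$ (identified when almost surely equal), with uniform convergence in probability (u.c.p.), i.e. $X^n\to X$ if $\sup_{t\le T}|X^n_t-X_t|\to0$ in probability. The covariation of two real processes is $[X,Y]_t=\lim_{\varepsilon\to0+}\frac1\varepsilon\int_0^t(X_{q+\varepsilon}-X_q)(Y_{q+\varepsilon}-Y_q)\,dq$ (limit u.c.p.), and $[W,W]$ is the matrix with entries $[W^i,W^j]$. For $l\in C_c([0,T]\times\mathbb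 R^d;\mathbb R^d)$ set $$A^{W,W}_t(l)=\Big(\int_0^t l^*(q,W_q)\,d[W,W]_q\Big)^*,\qquad t\in[0,T].$$ Let $-\frac12<s\le 0$ and $2\le r<\infty$, and suppose that $A^{W,W}$ is well defined on $C([0,T];H^s_r)$, that is, that the operator $A^{W,W}:C_c([0,T]\times\mathbb R^d;\mathbb R^d)\to\mathcal C$ has a continuous extension $A^{W,W}:C([0,T];H^s_r)\to\mathcal C$. Let $g\in C([0,T];H^s_r)\cap L^\infty_{\mathrm{loc}}([0,T]\times\mathbb R^d;\mathbb R^d)$, i.e. $g\in C([0,T];H^s_r)$ and there is a measurable function, still denoted by $g$, that is essentially bounded on $[0,T]\times K$ for every compact $K\subset\mathbb R^d$ and that represents the distribution $g(t)$ for almost every $t\in[0,T]$. Then, almost surely, $q\mapsto g(q,W_q)$ is integrable on $[0,T]$ and $$A^{W,W}_t(g)=\int_0^t g(q,W_q)\,dq\qquad\text{for all } t\in[0,T].$$ -/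

import Mathlib

open MeasureTheory ProbabilityTheory Filter Set
open scoped NNReal ENNReal Topology SchwartzMap

/-- The Euclidean space `ℝ^d`. -/
abbrev Rd (d : ℕ) : Type := EuclideanSpace ℝ (Fin d)

/-! ### Fractional Sobolev spaces -/

/-- The symbol of `(I - Δ/2)^(s/2)`. In Mathlib's normalization of the Fourier transform
`-Δ` has the symbol `(2π|ξ|)²`, so that `I - Δ/2` has the symbol `1 + 2π²|ξ|²`. -/
noncomputable def sobolevSymbol (d : ℕ) (s : ℝ) (ξ : Rd d) : ℝ :=
  (1 + 2 * Real.pi ^ 2 * ‖ξ‖ ^ 2) ^ (s / 2)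

theorem sobolevSymbol_hasTemperateGrowth (d : ℕ) (s : ℝ) :
    (sobolevSymbol d s).HasTemperateGrowth := by
  have h := (Function.hasTemperateGrowth_one_add_norm_sq_rpow (Rd d) (s / 2)).comp
    (((Real.sqrt 2 * Real.pi) • ContinuousLinearMap.id ℝ (Rd d)).hasTemperateGrowth)
  have h2 : Real.sqrt 2 ^ 2 = 2 := Real.sq_sqrt (by norm_num)
  have he : sobolevSymbol d s = (fun x : Rd d => (1 + ‖x‖ ^ 2) ^ (s / 2)) ∘
      ((Real.sqrt 2 * Real.pi) • ContinuousLinearMap.id ℝ (Rd d)) := by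
    funext ξ
    simp only [sobolevSymbol, Function.comp_apply, _root_.smul_apply,
      ContinuousLinearMap.id_apply, norm_smul, mul_pow, Real.norm_eq_abs, sq_abs, h2]
  rw [he]
  exact h

/-- The fractional power `(I - Δ/2)^(s/2)` on tempered distributions, by Fourier transform. -/
noncomputable def fracPower (d : ℕ) (s : ℝ) : 𝓢'(Rd d, ℂ) →L[ℂ] 𝓢'(Rd d, ℂ) :=
  TemperedDistribution.fourierMultiplierCLM ℂ (fun ξ => (sobolevSymbol d s ξ : ℂ))

theorem fracPower_neg_fracPower (d : ℕ) (s : ℝ) (u : 𝓢'(Rd d, ℂ)) :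
    fracPower d (-s) (fracPower d s u) = u := by
  have hg : ∀ a : ℝ, (fun ξ : Rd d => (sobolevSymbol d a ξ : ℂ)).HasTemperateGrowth := fun a =>
    Complex.ofRealCLM.hasTemperateGrowth.comp (sobolevSymbol_hasTemperateGrowth d a)
  unfold fracPower
  rw [TemperedDistribution.fourierMultiplierCLM_fourierMultiplierCLM_apply (hg s) (hg (-s))]
  have h1 : ((fun ξ : Rd d => (sobolevSymbol d s ξ : ℂ)) * fun ξ => (sobolevSymbol d (-s) ξ : ℂ)) =
      fun _ => (1 : ℂ) := by
    funext ξ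
    have hpos : (0 : ℝ) < 1 + 2 * Real.pi ^ 2 * ‖ξ‖ ^ 2 := by positivity
    simp only [Pi.mul_apply, sobolevSymbol]
    norm_cast
    rw [← Real.rpow_add hpos]
    ring_nf
    simp
  rw [h1]
  simp

/-- A tempered distribution is real if it takes real values on real test functions. -/
def IsRealDistribution {d : ℕ} (u : 𝓢'(Rd d, ℂ)) : Prop :=
  ∀ φ : 𝓢(Rd d, ℂ), (∀ x, (φ x).im = 0) → (u φ).im = 0

/-- The real fractional Sobolev space `H^s_r(ℝ^d)`: the real tempered distributions `u` with
`(I - Δ/2)^(s/2) u ∈ L^r(ℝ^d)`. -/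
noncomputable def sobolevSubmodule (d : ℕ) (s : ℝ) (r : ℝ≥0∞) [Fact (1 ≤ r)] :
    Submodule ℝ 𝓢'(Rd d, ℂ) where
  carrier := {u | IsRealDistribution u ∧
    ∃ f : Lp ℂ r (volume : Measure (Rd d)), fracPower d s u = (f : 𝓢'(Rd d, ℂ))}
  zero_mem' := by
    refine ⟨fun φ _ => by simp, 0, ?_⟩
    rw [map_zero, ← Lp.toTemperedDistributionCLM_apply, map_zero]
  add_mem' := by
    rintro u v ⟨hu, f, hf⟩ ⟨hv, g, hg⟩
    refine ⟨fun φ hφ => ?_, f + g, ?_⟩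
    · simp [hu φ hφ, hv φ hφ]
    · rw [map_add, ← Lp.toTemperedDistributionCLM_apply, map_add, hf, hg]
      rfl
  smul_mem' := by
    rintro c u ⟨hu, f, hf⟩
    refine ⟨fun φ hφ => ?_, (c : ℂ) • f, ?_⟩
    · simp [hu φ hφ]
    · have hc : c • u = (c : ℂ) • u := by ext φ; simp
      rw [hc, map_smul, ← Lp.toTemperedDistributionCLM_apply, map_smul, hf]
      rfl

/-- The space `H^s_r(ℝ^d)` as a type of its own, so that it does not inherit the topology of the
tempered distributions. -/
def Sobolev (d : ℕ) (s : ℝ) (r : ℝ≥0∞) [Fact (1 ≤ r)] : Type := sobolevSubmodule d s r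

namespace Sobolev

variable {d : ℕ} {s : ℝ} {r : ℝ≥0∞} [Fact (1 ≤ r)]

noncomputable instance instAddCommGroup : AddCommGroup (Sobolev d s r) :=
  inferInstanceAs (AddCommGroup (sobolevSubmodule d s r))

noncomputable instance instModule : Module ℝ (Sobolev d s r) :=
  inferInstanceAs (Module ℝ (sobolevSubmodule d s r))

/-- The distribution underlying an element of `H^s_r`. -/
noncomputable def toDistribution (d : ℕ) (s : ℝ) (r : ℝ≥0∞) [Fact (1 ≤ r)] :
    Sobolev d s r →ₗ[ℝ] 𝓢'(Rd d, ℂ) :=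
  (sobolevSubmodule d s r).subtype

/-- The function `(I - Δ/2)^(s/2) u ∈ L^r` of `u ∈ H^s_r`. -/
noncomputable def toLp (u : Sobolev d s r) : Lp ℂ r (volume : Measure (Rd d)) :=
  u.2.2.choose

theorem toLp_spec (u : Sobolev d s r) :
    fracPower d s (toDistribution d s r u) = (u.toLp : 𝓢'(Rd d, ℂ)) :=
  u.2.2.choose_spec

theorem toTemperedDistribution_injective :
    Function.Injective (Lp.toTemperedDistributionCLM ℂ (volume : Measure (Rd d)) r) :=
  LinearMap.ker_eq_bot.mp Lp.ker_toTemperedDistributionCLM_eq_bot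

theorem toLp_add (u v : Sobolev d s r) : (u + v).toLp = u.toLp + v.toLp := by
  apply toTemperedDistribution_injective
  rw [map_add]
  simp only [Lp.toTemperedDistributionCLM_apply, ← toLp_spec]
  rw [map_add, map_add]

theorem toLp_smul (c : ℝ) (u : Sobolev d s r) : (c • u).toLp = c • u.toLp := by
  have hc : c • u.toLp = (c : ℂ) • u.toLp := by
    ext1
    filter_upwards [Lp.coeFn_smul c u.toLp, Lp.coeFn_smul (c : ℂ) u.toLp] with x h1 h2
    rw [h1, h2]
    simp
  have hu : toDistribution d s r (c • u) = (c : ℂ) • toDistribution d s r u := by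
    rw [map_smul]
    ext φ
    simp
  rw [hc]
  apply toTemperedDistribution_injective
  rw [map_smul]
  simp only [Lp.toTemperedDistributionCLM_apply, ← toLp_spec]
  rw [hu, map_smul]

/-- The map `(I - Δ/2)^(s/2) : H^s_r → L^r`. -/
noncomputable def toLpHom (d : ℕ) (s : ℝ) (r : ℝ≥0∞) [Fact (1 ≤ r)] :
    Sobolev d s r →ₗ[ℝ] Lp ℂ r (volume : Measure (Rd d)) where
  toFun := toLp
  map_add' := toLp_add
  map_smul' := toLp_smul

theorem toLpHom_injective : Function.Injective (toLpHom d s r) := by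
  intro u v h
  have h' : u.toLp = v.toLp := h
  have h2 : toDistribution d s r u = toDistribution d s r v := by
    rw [← fracPower_neg_fracPower d s (toDistribution d s r u),
      ← fracPower_neg_fracPower d s (toDistribution d s r v), toLp_spec, toLp_spec, h']
  exact Subtype.ext h2

/-- `H^s_r` carries the norm `‖u‖ = ‖(I - Δ/2)^(s/2) u‖_{L^r}`. -/
noncomputable instance instNormedAddCommGroup : NormedAddCommGroup (Sobolev d s r) :=
  NormedAddCommGroup.induced (Sobolev d s r) (Lp ℂ r (volume : Measure (Rd d)))
    (toLpHom d s r) toLpHom_injective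

end Sobolev

/-- The space `H^s_r(ℝ^d; ℝ^d)`, defined componentwise. -/
abbrev SobolevVec (d : ℕ) (s : ℝ) (r : ℝ≥0∞) [Fact (1 ≤ r)] : Type := Fin d → Sobolev d s r

/-! ### Time dependent functions -/

/-- `l ∈ C_c([0,T] × ℝ^d; ℝ^d)`; only the values of `l` at times in `[0,T]` matter. -/
def IsContinuousCompactSupport {d : ℕ} (T : ℝ) (l : ℝ → Rd d → Rd d) : Prop :=
  ContinuousOn (Function.uncurry l) (Icc 0 T ×ˢ univ) ∧
    ∃ K : Set (Rd d), IsCompact K ∧ ∀ t ∈ Icc 0 T, ∀ x ∉ K, l t x = 0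

/-- `g ∈ L^∞_loc([0,T] × ℝ^d; ℝ^d)`: measurable and essentially bounded on `[0,T] × K` for every
compact `K`. -/
def IsLocallyBounded {d : ℕ} (T : ℝ) (g : ℝ → Rd d → Rd d) : Prop :=
  ∀ K : Set (Rd d), IsCompact K →
    MemLp (Function.uncurry g) ∞ ((volume : Measure (ℝ × Rd d)).restrict (Icc 0 T ×ˢ K))

/-- The element `u` of `C([0,T]; H^s_r)` is the function `g` (given up to null sets of
`[0,T] × ℝ^d`): for almost every `t`, the distribution `u(t)` is integration against `g(t, ·)`,
component by component, on compactly supported test functions. -/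
def IsGivenBy {d : ℕ} {s : ℝ} {r : ℝ≥0∞} [Fact (1 ≤ r)] {T : ℝ}
    (u : C(Icc (0 : ℝ) T, SobolevVec d s r)) (g : ℝ → Rd d → Rd d) : Prop :=
  ∀ᵐ t ∂(volume : Measure ℝ), ∀ ht : t ∈ Icc (0 : ℝ) T, ∀ i : Fin d, ∀ φ : 𝓢(Rd d, ℂ),
    HasCompactSupport φ →
      Sobolev.toDistribution d s r (u ⟨t, ht⟩ i) φ = ∫ x, φ x * ((g t x i : ℝ) : ℂ)

/-! ### Processes -/

/-- `W` is a standard `d`-dimensional Brownian motion (started at `0`, almost surely continuous):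
its components are independent real Brownian motions. -/
structure IsBrownianVec {Ω : Type*} [MeasurableSpace Ω] {d : ℕ} (W : ℝ≥0 → Ω → Rd d)
    (P : Measure Ω) : Prop where
  measurable : ∀ t, Measurable (W t)
  isBrownianReal : ∀ i, IsBrownianReal (fun t ω => W t ω i) P
  independent : iIndepFun (fun (i : Fin d) (ω : Ω) (t : ℝ≥0) => W t ω i) P

/-- Continuous stochastic processes indexed by `[0,T]`; only the values at times in `[0,T]`
matter. -/
structure ContinuousProcess (Ω : Type*) [MeasurableSpace Ω] (T : ℝ) (F : Type*)
    [TopologicalSpace F] [MeasurableSpace F] where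
  val : ℝ → Ω → F
  measurable : ∀ t ∈ Icc 0 T, Measurable (val t)
  continuousOn : ∀ ω, ContinuousOn (fun t => val t ω) (Icc 0 T)

/-- Uniform convergence in probability on `[0,T]` (u.c.p.):
`sup_{t ∈ [0,T]} |X^n_t - X_t| → 0` in probability. -/
def TendstoUCP {Ω ι F : Type*} [MeasurableSpace Ω] [PseudoMetricSpace F] (P : Measure Ω) (T : ℝ)
    (X : ι → ℝ → Ω → F) (a : Filter ι) (Y : ℝ → Ω → F) : Prop :=
  ∀ η : ℝ, 0 < η →
    Tendsto (fun n => P {ω | ∃ t ∈ Icc 0 T, η ≤ dist (X n t ω) (Y t ω)}) a (𝓝 0)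

/-- `C` is the covariation `[X, Y]` on `[0,T]`, in the sense of regularization:
`[X,Y]_t = lim_{ε → 0+} (1/ε) ∫_0^t (X_{s+ε} - X_s) (Y_{s+ε} - Y_s) ds` u.c.p. -/
def IsCovariation {Ω : Type*} [MeasurableSpace Ω] (P : Measure Ω) (T : ℝ) (X Y : ℝ≥0 → Ω → ℝ)
    (C : ℝ → Ω → ℝ) : Prop :=
  TendstoUCP P T
    (fun (ε : ℝ) t ω => ε⁻¹ * ∫ s in (0 : ℝ)..t,
      (X (s + ε).toNNReal ω - X s.toNNReal ω) * (Y (s + ε).toNNReal ω - Y s.toNNReal ω))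
    (𝓝[>] 0) C

/-- `I = ∫_0^t f dc`, as a limit of Riemann-Stieltjes sums. For `f` continuous and `c` continuous
of bounded variation, the only case in use, the limit exists and it is the Lebesgue-Stieltjes
integral. -/
def IsStieltjesIntegral (f c : ℝ → ℝ) (t I : ℝ) : Prop :=
  Tendsto (fun n : ℕ => ∑ k ∈ Finset.range n,
    f (t * k / n) * (c (t * (k + 1) / n) - c (t * k / n))) atTop (𝓝 I)

/-- `C` is the covariation matrix `[W, Y]` on `[0,T]`, and its entries have finite variation. -/
def IsFVCovariationMatrix {Ω : Type*} [MeasurableSpace Ω] {d : ℕ} (P : Measure Ω) (T : ℝ)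
    (W Y : ℝ≥0 → Ω → Rd d) (C : Fin d → Fin d → ContinuousProcess Ω T ℝ) : Prop :=
  ∀ i j, IsCovariation P T (fun t ω => W t ω i) (fun t ω => Y t ω j) (C i j).val ∧
    ∀ᵐ ω ∂P, BoundedVariationOn (fun t => (C i j).val t ω) (Icc 0 T)

/-- `X` is the process `(∫_0^· l(r, W_r)^* d[W, Y]_r)^*`, where `C = [W, Y]`. -/
def IsIntegralAgainst {Ω : Type*} [MeasurableSpace Ω] {d : ℕ} (P : Measure Ω) {T : ℝ}
    (W : ℝ≥0 → Ω → Rd d) (C : Fin d → Fin d → ContinuousProcess Ω T ℝ) (l : ℝ → Rd d → Rd d)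
    (X : ContinuousProcess Ω T (Rd d)) : Prop :=
  ∀ᵐ ω ∂P, ∀ t ∈ Icc 0 T, ∃ I : Fin d → Fin d → ℝ,
    (∀ i j, IsStieltjesIntegral (fun q => l q (W q.toNNReal ω) i) (fun q => (C i j).val q ω)
      t (I i j)) ∧
    ∀ j, X.val t ω j = ∑ i, I i j

/-- The integral operator `A^{W,Y}` is well defined on `E = C([0,T]; H^s_r)` and is equal to `A`:
the covariation `[W, Y]` exists and has finite variation, and `A`, with values in the continuous
processes with u.c.p. convergence, is a continuous extension of
`l ↦ (∫_0^· l(r, W_r)^* d[W, Y]_r)^*`, `l ∈ C_c([0,T] × ℝ^d; ℝ^d)`. Processes are identified if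
they are almost surely equal. -/
structure IsIntegralOperator {Ω : Type*} [MeasurableSpace Ω] {d : ℕ} {s : ℝ} {r : ℝ≥0∞}
    [Fact (1 ≤ r)] {T : ℝ} (P : Measure Ω) (W Y : ℝ≥0 → Ω → Rd d)
    (A : C(Icc (0 : ℝ) T, SobolevVec d s r) → ContinuousProcess Ω T (Rd d)) : Prop where
  extension : ∃ C : Fin d → Fin d → ContinuousProcess Ω T ℝ, IsFVCovariationMatrix P T W Y C ∧
    ∀ l, IsContinuousCompactSupport T l →
      ∀ u : C(Icc (0 : ℝ) T, SobolevVec d s r), IsGivenBy u l → IsIntegralAgainst P W C l (A u)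
  continuity : ∀ u, TendstoUCP P T (fun v => (A v).val) (𝓝 u) (A u).val

/-!
The operator `(I - Δ/2)^(s/2)`, `s ≤ 0`, averages translates against a probability measure, a
gamma mixture of Gaussians. Hence it is a contraction of `L^r` that commutes with mollification, so
that cut off mollifications of `u` belong to `C_c([0,T] × ℝ^d; ℝ^d)` and converge to `u` in
`C([0,T]; H^s_r)`, and `A(u)` is the limit of their images under `A`.

For `l ∈ C_c([0,T] × ℝ^d; ℝ^d)` we have `A_t(l) = ∫_0^t l(q, W_q) dq`, because `[W, W]_t` is `t`
times the identity matrix: the time averages of `(W^i_{q+ε} - W^i_q) (W^j_{q+ε} - W^j_q) / ε`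
converge to their means, since these products are uncorrelated at times more than `ε` apart.

Mollifications of the locally bounded function `g` are locally bounded uniformly in the radius of
the mollifier, and they converge to `g` almost everywhere by Lebesgue differentiation. The law of
`W_q`, `q > 0`, is absolutely continuous, so this convergence holds along almost every Brownian path
at almost every time, and bounded convergence identifies the limit of the time integrals.
-/

/-! ### Averages of translates in `L^r` -/

section ShiftAverage

variable {E : Type*} [NormedAddCommGroup E] [NormedSpace ℝ E] [MeasurableSpace E]
  [BorelSpace E] {μ ν : Measure E} [μ.IsAddHaarMeasure] {r : ℝ≥0∞}
  [Fact (1 ≤ r)]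

theorem lintegral_mul_shift_le (φ : 𝓢(E, ℂ)) (f : Lp ℂ r μ) (y : E) :
    ∫⁻ x, ‖φ x * f (y + x)‖ₑ ∂μ ≤ eLpNorm φ (1 - r⁻¹)⁻¹ μ * eLpNorm f r μ := by
  have : ENNReal.HolderConjugate r (1 - r⁻¹)⁻¹ := ENNReal.HolderConjugate.inv_one_sub_inv' Fact.out
  have : ENNReal.HolderTriple (1 - r⁻¹)⁻¹ r 1 := ENNReal.HolderTriple.symm
  have hshift := measurePreserving_add_left μ y
  have hf : AEStronglyMeasurable (fun x => f (y + x)) μ :=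
    (Lp.aestronglyMeasurable f).comp_measurePreserving hshift
  calc ∫⁻ x, ‖φ x * f (y + x)‖ₑ ∂μ
      ≤ eLpNorm φ (1 - r⁻¹)⁻¹ μ * eLpNorm (fun x => f (y + x)) r μ := by
        have h := eLpNorm_smul_le_mul_eLpNorm (p := (1 - r⁻¹)⁻¹) (q := r) (r := 1) hf
          (φ.continuous.aestronglyMeasurable (μ := μ))
        rwa [eLpNorm_one_eq_lintegral_enorm] at h
    _ = eLpNorm φ (1 - r⁻¹)⁻¹ μ * eLpNorm f r μ := by
        congr 1
        exact eLpNorm_comp_measurePreserving (Lp.aestronglyMeasurable f) hshift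

variable [FiniteDimensional ℝ E]

theorem integrable_mul_mul_shift {h : E → ℂ} (hh : Integrable h ν) (φ : 𝓢(E, ℂ))
    (f : Lp ℂ r μ) :
    Integrable (fun p : E × E => h p.1 * (φ p.2 * f (p.1 + p.2))) (ν.prod μ) := by
  have hm : AEStronglyMeasurable (fun p : E × E => h p.1 * (φ p.2 * f (p.1 + p.2)))
      (ν.prod μ) := by
    refine hh.1.comp_fst.mul (AEStronglyMeasurable.mul ?_ ?_)
    · exact (φ.continuous.comp continuous_snd).aestronglyMeasurable
    · exact ((Lp.stronglyMeasurable f).comp_measurable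
        (measurable_fst.add measurable_snd)).aestronglyMeasurable
  have hfin : eLpNorm φ (1 - r⁻¹)⁻¹ μ * eLpNorm f r μ ≠ ∞ :=
    ENNReal.mul_ne_top (φ.memLp _ _).2.ne (Lp.eLpNorm_ne_top f)
  refine ⟨hm, ?_⟩
  rw [HasFiniteIntegral, lintegral_prod _ hm.enorm]
  calc ∫⁻ y, ∫⁻ x, ‖h y * (φ x * f (y + x))‖ₑ ∂μ ∂ν
      ≤ ∫⁻ y, ‖h y‖ₑ * (eLpNorm φ (1 - r⁻¹)⁻¹ μ * eLpNorm f r μ) ∂ν := by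
        refine lintegral_mono fun y => ?_
        simp only [enorm_mul (h y)]
        rw [lintegral_const_mul' _ _ enorm_ne_top]
        gcongr
        exact lintegral_mul_shift_le φ f y
    _ < ∞ := by
        rw [lintegral_mul_const' _ _ hfin]
        exact ENNReal.mul_lt_top hh.2 hfin.lt_top

/-- The pairing of a test function `φ` with `L^r`, as a continuous linear functional on `L^r`. -/
noncomputable def lpPair (φ : 𝓢(E, ℂ)) : Lp ℂ r μ →L[ℂ] ℂ :=
  haveI := ENNReal.HolderConjugate.inv_one_sub_inv' (Fact.out : 1 ≤ r)
  haveI : Fact (1 ≤ (1 - r⁻¹)⁻¹) := by simp [fact_iff]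
  ((ContinuousLinearMap.lsmul ℂ ℂ (E := ℂ)).flip.lpPairing μ r (1 - r⁻¹)⁻¹).flip
    (φ.toLp (1 - r⁻¹)⁻¹ μ)

theorem toTemperedDistribution_apply_eq_lpPair (f : Lp ℂ r μ) (φ : 𝓢(E, ℂ)) :
    (f : 𝓢'(E, ℂ)) φ = lpPair φ f := rfl

theorem lpPair_eq_integral (φ : 𝓢(E, ℂ)) (f : Lp ℂ r μ) : lpPair φ f = ∫ x, φ x * f x ∂μ := by
  simp only [← toTemperedDistribution_apply_eq_lpPair, Lp.toTemperedDistribution_apply, smul_eq_mul]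

theorem lpPair_shift (φ : 𝓢(E, ℂ)) (f : Lp ℂ r μ) (y : E) :
    lpPair φ (DomAddAct.mk y +ᵥ f) = ∫ x, φ x * f (y + x) ∂μ := by
  rw [lpPair_eq_integral]
  refine integral_congr_ae ?_
  filter_upwards [DomAddAct.vadd_Lp_ae_eq (DomAddAct.mk y) f] with x hx
  rw [hx]
  rfl

theorem lpPair_compSubConst (φ : 𝓢(E, ℂ)) (f : Lp ℂ r μ) (y : E) :
    lpPair (φ.compSubConstCLM ℂ y) f = lpPair φ (DomAddAct.mk y +ᵥ f) := by
  rw [lpPair_shift, lpPair_eq_integral, ← integral_add_left_eq_self _ y]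
  simp

variable [Fact (r ≠ ∞)]

theorem continuous_shift (f : Lp ℂ r μ) : Continuous fun y : E => DomAddAct.mk y +ᵥ f := by
  fun_prop

theorem integrable_smul_shift {h : E → ℂ} (hh : Integrable h ν) (f : Lp ℂ r μ) :
    Integrable (fun y => h y • (DomAddAct.mk y +ᵥ f)) ν := by
  refine (hh.norm.mul_const ‖f‖).mono' (hh.1.smul (continuous_shift f).aestronglyMeasurable)
    (ae_of_all _ fun y => ?_)
  rw [norm_smul, DomAddAct.norm_vadd_Lp]

/-- The average `∫ h(y) f(y + ·) dν(y)` of the translates of `f ∈ L^r`. With `ν` a general measure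
it covers both convolution operators and averages over the law of a random vector. -/
noncomputable def shiftAverage {h : E → ℂ} (hh : Integrable h ν) : Lp ℂ r μ →L[ℂ] Lp ℂ r μ :=
  LinearMap.mkContinuous
    { toFun := fun f => ∫ y, h y • (DomAddAct.mk y +ᵥ f) ∂ν
      map_add' := fun f g => by
        simp only [DomAddAct.vadd_Lp_add, smul_add]
        exact integral_add (integrable_smul_shift hh f) (integrable_smul_shift hh g)
      map_smul' := fun c f => by
        have hc : ∀ y : E, DomAddAct.mk y +ᵥ (c • f) = c • (DomAddAct.mk y +ᵥ f) := fun y => by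
          rcases f with ⟨⟨_⟩, _⟩; rfl
        simp only [hc, smul_comm _ c, RingHom.id_apply, integral_smul] }
    (∫ y, ‖h y‖ ∂ν) fun f => by
      refine (norm_integral_le_integral_norm _).trans (le_of_eq ?_)
      simp only [norm_smul, DomAddAct.norm_vadd_Lp, integral_mul_const]

theorem shiftAverage_apply {h : E → ℂ} (hh : Integrable h ν) (f : Lp ℂ r μ) :
    shiftAverage hh f = ∫ y, h y • (DomAddAct.mk y +ᵥ f) ∂ν := rfl

theorem norm_shiftAverage_apply_le {h : E → ℂ} (hh : Integrable h ν) (f : Lp ℂ r μ) :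
    ‖shiftAverage hh f‖ ≤ (∫ y, ‖h y‖ ∂ν) * ‖f‖ :=
  ContinuousLinearMap.le_of_opNorm_le _
    (LinearMap.mkContinuous_norm_le _ (integral_nonneg fun _ => norm_nonneg _) _) f

theorem lpPair_shiftAverage {h : E → ℂ} (hh : Integrable h ν) (φ : 𝓢(E, ℂ)) (f : Lp ℂ r μ) :
    lpPair φ (shiftAverage hh f) = ∫ y, h y * lpPair φ (DomAddAct.mk y +ᵥ f) ∂ν := by
  rw [shiftAverage_apply, ← ContinuousLinearMap.integral_comp_comm _ (integrable_smul_shift hh f)]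
  simp only [map_smul, smul_eq_mul]

theorem lpPair_shiftAverage_eq_integral_integral [SFinite ν] {h : E → ℂ} (hh : Integrable h ν)
    (φ : 𝓢(E, ℂ)) (f : Lp ℂ r μ) :
    lpPair φ (shiftAverage hh f) = ∫ x, φ x * ∫ y, h y * f (y + x) ∂ν ∂μ := by
  calc lpPair φ (shiftAverage hh f) = ∫ y, ∫ x, h y * (φ x * f (y + x)) ∂μ ∂ν := by
        simp only [lpPair_shiftAverage, lpPair_shift, integral_const_mul]
    _ = ∫ x, ∫ y, h y * (φ x * f (y + x)) ∂ν ∂μ :=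
        integral_integral_swap (integrable_mul_mul_shift hh φ f)
    _ = ∫ x, φ x * ∫ y, h y * f (y + x) ∂ν ∂μ := by
        simp only [← integral_const_mul, mul_left_comm]

theorem shiftAverage_ae_eq_lpPair_shift (κ : 𝓢(E, ℂ)) (f : Lp ℂ r μ) :
    shiftAverage (κ.integrable (μ := μ)) f =ᵐ[μ] fun x => lpPair κ (DomAddAct.mk x +ᵥ f) := by
  have hl₁ : LocallyIntegrable (shiftAverage (κ.integrable (μ := μ)) f : E → ℂ) μ :=
    (Lp.memLp _).locallyIntegrable Fact.out
  have hl₂ : LocallyIntegrable (fun x => lpPair κ (DomAddAct.mk x +ᵥ f)) μ :=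
    ((lpPair κ).continuous.comp (continuous_shift f)).locallyIntegrable
  refine ae_eq_of_integral_contDiff_smul_eq hl₁ hl₂ fun g hg hgc => ?_
  have hcs : HasCompactSupport (Complex.ofRealCLM ∘ g) := hgc.comp_left rfl
  have hcd : ContDiff ℝ (⊤ : ℕ∞) (Complex.ofRealCLM ∘ g) := by fun_prop
  calc ∫ x, g x • shiftAverage (κ.integrable (μ := μ)) f x ∂μ
      = lpPair (hcs.toSchwartzMap hcd) (shiftAverage (κ.integrable (μ := μ)) f) := by
        rw [lpPair_eq_integral]; simp
    _ = ∫ x, g x • lpPair κ (DomAddAct.mk x +ᵥ f) ∂μ := by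
        simp [lpPair_shiftAverage_eq_integral_integral, lpPair_shift, add_comm]

end ShiftAverage

/-! ### Averages of translates as Fourier multipliers -/

section Multiplier

open FourierTransform RealInnerProductSpace

variable {E : Type*} [NormedAddCommGroup E] [InnerProductSpace ℝ E] [MeasurableSpace E]

/-- The symbol of the Fourier multiplier `f ↦ ∫ h(y) f(y + ·) dν(y)`: the inverse Fourier transform
of the complex measure `h dν`. -/
noncomputable def averageSymbol (ν : Measure E) (h : E → ℂ) (ξ : E) : ℂ :=
  ∫ y, Real.fourierChar ⟪y, ξ⟫ • h y ∂ν

theorem averageSymbol_one_eq_charFun (ν : Measure E) (ξ : E) :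
    averageSymbol ν (fun _ => 1) ξ = charFun ν ((2 * Real.pi) • ξ) := by
  simp [averageSymbol, charFun_apply, Circle.smul_def, Real.fourierChar_apply, inner_smul_right]

variable [BorelSpace E] [FiniteDimensional ℝ E]

theorem averageSymbol_volume (κ : 𝓢(E, ℂ)) : averageSymbol volume κ = (𝓕⁻ κ : 𝓢(E, ℂ)) := by
  funext ξ
  rw [SchwartzMap.fourierInv_coe, Real.fourierInv_eq, averageSymbol]

theorem averageSymbol_volume_hasTemperateGrowth (κ : 𝓢(E, ℂ)) :
    (averageSymbol volume κ).HasTemperateGrowth := by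
  rw [averageSymbol_volume]
  exact SchwartzMap.hasTemperateGrowth _

theorem integral_averageSymbol_mul {ν : Measure E} [SigmaFinite ν] {h g : E → ℂ}
    (hh : Integrable h ν) (hg : Integrable g) :
    ∫ ξ, averageSymbol ν h ξ * g ξ = ∫ y, h y * 𝓕⁻ g y ∂ν := by
  have hL : Continuous fun p : E × E => (-innerₗ E) p.1 p.2 := by
    simp only [LinearMap.neg_apply, innerₗ_apply_apply]; fun_prop
  have key := VectorFourier.integral_fourierIntegral_smul_eq_flip Real.continuous_fourierChar hL
    hh hg
  simpa [VectorFourier.fourierIntegral, averageSymbol, Real.fourierInv_eq, real_inner_comm]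
    using key

theorem fourierInv_fourierChar_smul_fourierInv (φ : 𝓢(E, ℂ)) (x y : E) :
    𝓕⁻ (fun ξ => Real.fourierChar (-⟪ξ, x⟫) • (𝓕⁻ φ : 𝓢(E, ℂ)) ξ) y = φ (x - y) := by
  have hφ : φ (x - y) = (𝓕 (𝓕⁻ φ : 𝓢(E, ℂ)) : 𝓢(E, ℂ)) (x - y) := by
    rw [FourierTransform.fourier_fourierInv_eq]
  rw [hφ, SchwartzMap.fourier_coe, Real.fourier_eq, Real.fourierInv_eq]
  congr 1; funext ξ
  rw [smul_smul, ← AddChar.map_add_eq_mul, inner_sub_right, neg_sub, sub_eq_add_neg]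

theorem fourier_averageSymbol_mul_fourierInv {ν : Measure E} [SigmaFinite ν] {h : E → ℂ}
    (hh : Integrable h ν) (hm : (averageSymbol ν h).HasTemperateGrowth) (φ : 𝓢(E, ℂ)) (x : E) :
    (𝓕 (SchwartzMap.smulLeftCLM ℂ (averageSymbol ν h) (𝓕⁻ φ)) : 𝓢(E, ℂ)) x =
      ∫ y, h y * φ (x - y) ∂ν := by
  have hg : Integrable fun ξ => Real.fourierChar (-⟪ξ, x⟫) • (𝓕⁻ φ : 𝓢(E, ℂ)) ξ :=
    (Real.fourierIntegral_convergent_iff x).2 (SchwartzMap.integrable _)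
  rw [SchwartzMap.fourier_coe, Real.fourier_eq]
  simp only [SchwartzMap.smulLeftCLM_apply_apply hm, ← fourierInv_fourierChar_smul_fourierInv φ x,
    ← integral_averageSymbol_mul hh hg, smul_eq_mul, mul_smul_comm]

variable {r : ℝ≥0∞} [Fact (1 ≤ r)]

theorem integrable_mul_comp_sub_mul {ν : Measure E} [SFinite ν] {h : E → ℂ} (hh : Integrable h ν)
    (φ : 𝓢(E, ℂ)) (f : Lp ℂ r (volume : Measure E)) :
    Integrable (fun p : E × E => h p.1 * (φ (p.2 - p.1) * f p.2)) (ν.prod volume) := by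
  have hmp : MeasurePreserving (fun p : E × E => (p.1, -p.1 + p.2)) (ν.prod volume)
      (ν.prod volume) :=
    (MeasurePreserving.id ν).skew_product (by fun_prop)
      (ae_of_all _ fun y => (measurePreserving_add_left volume (-y)).map_eq)
  refine (hmp.integrable_comp_of_integrable (integrable_mul_mul_shift hh φ f)).congr
    (ae_of_all _ fun p => ?_)
  simp [neg_add_eq_sub]

variable [Fact (r ≠ ∞)]

theorem toTemperedDistribution_shiftAverage {ν : Measure E} [SigmaFinite ν] {h : E → ℂ}
    (hh : Integrable h ν) (hm : (averageSymbol ν h).HasTemperateGrowth)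
    (f : Lp ℂ r (volume : Measure E)) :
    (shiftAverage hh f : 𝓢'(E, ℂ)) =
      TemperedDistribution.fourierMultiplierCLM ℂ (averageSymbol ν h) (f : 𝓢'(E, ℂ)) := by
  ext φ
  rw [TemperedDistribution.fourierMultiplierCLM_apply_apply,
    toTemperedDistribution_apply_eq_lpPair, Lp.toTemperedDistribution_apply]
  calc lpPair φ (shiftAverage hh f) = ∫ y, (∫ x, h y * (φ (x - y) * f x)) ∂ν := by
        simp only [lpPair_shiftAverage, ← lpPair_compSubConst]
        simp only [lpPair_eq_integral, SchwartzMap.compSubConstCLM_apply, integral_const_mul]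
    _ = ∫ x, ∫ y, h y * (φ (x - y) * f x) ∂ν :=
        integral_integral_swap (integrable_mul_comp_sub_mul hh φ f)
    _ = _ := by
        simp only [fourier_averageSymbol_mul_fourierInv hh hm, smul_eq_mul, ← integral_mul_const,
          mul_assoc]

end Multiplier

/-! ### The Bessel potential of nonpositive order -/

section Bessel

theorem integral_exp_neg_mul_gammaMeasure {a c : ℝ} (ha : 0 < a) (hc : 0 ≤ c) :
    ∫ τ, Real.exp (-(c * τ)) ∂(gammaMeasure a 1) = (1 + c) ^ (-a) := by
  have hmeas : Measurable (gammaPDF a 1) := (measurable_gammaPDFReal a 1).ennreal_ofReal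
  rw [gammaMeasure, integral_withDensity_eq_integral_toReal_smul hmeas (by simp [gammaPDF])]
  have hdensity : (fun τ => (gammaPDF a 1 τ).toReal • Real.exp (-(c * τ))) =
      (Ici (0 : ℝ)).indicator fun τ =>
        (Real.Gamma a)⁻¹ * (τ ^ (a - 1) * Real.exp (-((1 + c) * τ))) := by
    funext τ
    rw [gammaPDF, ENNReal.toReal_ofReal (gammaPDFReal_nonneg ha one_pos τ), gammaPDFReal]
    by_cases hτ : 0 ≤ τ
    · rw [indicator_of_mem (mem_Ici.2 hτ), if_pos hτ, smul_eq_mul, add_mul, neg_add, Real.exp_add,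
        Real.one_rpow, one_div, mul_assoc, mul_assoc]
    · rw [indicator_of_notMem (notMem_Ici.2 (not_le.1 hτ)), if_neg hτ, zero_smul]
  rw [hdensity, integral_indicator measurableSet_Ici, integral_Ici_eq_integral_Ioi,
    integral_const_mul, Real.integral_rpow_mul_exp_neg_mul_Ioi ha (by linarith), one_div,
    Real.inv_rpow (by linarith), Real.rpow_neg (by linarith),
    mul_left_comm, inv_mul_cancel₀ (Real.Gamma_pos_of_pos ha).ne', mul_one]

theorem ae_nonneg_gammaMeasure (a b : ℝ) : ∀ᵐ τ ∂(gammaMeasure a b), 0 ≤ τ := by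
  have hm : Measurable (gammaPDF a b) := (measurable_gammaPDFReal a b).ennreal_ofReal
  rw [gammaMeasure, ae_withDensity_iff hm]
  refine ae_of_all _ fun τ hτ => ?_
  by_contra h
  exact hτ (gammaPDF_of_neg (not_le.mp h))

/-- The law of a Gaussian vector with covariance `τ I` at an independent random time `τ` of law `ρ`,
where `ρ` is supported on `[0, ∞)`. -/
noncomputable def gaussianMixture (E : Type*) [NormedAddCommGroup E] [InnerProductSpace ℝ E]
    [FiniteDimensional ℝ E] [MeasurableSpace E] (ρ : Measure ℝ) : Measure E :=
  (ρ.prod (stdGaussian E)).map fun p => √p.1 • p.2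

instance isProbabilityMeasure_gaussianMixture {E : Type*} [NormedAddCommGroup E]
    [InnerProductSpace ℝ E] [FiniteDimensional ℝ E] [MeasurableSpace E] [BorelSpace E]
    (ρ : Measure ℝ) [IsProbabilityMeasure ρ] : IsProbabilityMeasure (gaussianMixture E ρ) :=
  Measure.isProbabilityMeasure_map (by fun_prop)

theorem charFun_gaussianMixture {E : Type*} [NormedAddCommGroup E] [InnerProductSpace ℝ E]
    [FiniteDimensional ℝ E] [MeasurableSpace E] [BorelSpace E] {ρ : Measure ℝ} [IsFiniteMeasure ρ]
    (hρ : ∀ᵐ τ ∂ρ, 0 ≤ τ) (ξ : E) :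
    charFun (gaussianMixture E ρ) ξ = (∫ τ, Real.exp (-(‖ξ‖ ^ 2 / 2 * τ)) ∂ρ : ℝ) := by
  have hmeas : Measurable fun p : ℝ × E => √p.1 • p.2 := by fun_prop
  have hcont : Continuous fun z : E => Complex.exp ((inner ℝ z ξ : ℝ) * Complex.I) := by fun_prop
  have hint : Integrable (fun p : ℝ × E =>
      Complex.exp ((inner ℝ (√p.1 • p.2) ξ : ℝ) * Complex.I)) (ρ.prod (stdGaussian E)) :=
    Integrable.of_bound (hcont.measurable.comp hmeas).aestronglyMeasurable 1
      (ae_of_all _ fun p => (Complex.norm_exp_ofReal_mul_I _).le)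
  rw [charFun_apply, gaussianMixture, integral_map hmeas.aemeasurable hcont.aestronglyMeasurable,
    integral_prod _ hint, ← integral_complex_ofReal]
  refine integral_congr_ae ?_
  filter_upwards [hρ] with τ hτ
  simp only [real_inner_smul_left, ← inner_smul_right]
  have hsq : ‖√τ • ξ‖ ^ 2 = τ * ‖ξ‖ ^ 2 := by
    rw [norm_smul, mul_pow, Real.norm_of_nonneg (Real.sqrt_nonneg τ), Real.sq_sqrt hτ]
  rw [← charFun_apply, charFun_stdGaussian, ← Complex.ofReal_pow, hsq]
  push_cast
  congr 1; ring

/-- The law of the random time whose Laplace transform is `c ↦ (1 + c)^(-a)`, `a ≥ 0`. The case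
`a = 0` is separate because `gammaMeasure 0 1` is not a probability measure. -/
noncomputable def besselTimeLaw (a : ℝ) : Measure ℝ :=
  if 0 < a then gammaMeasure a 1 else Measure.dirac 0

instance isProbabilityMeasure_besselTimeLaw (a : ℝ) : IsProbabilityMeasure (besselTimeLaw a) := by
  rw [besselTimeLaw]
  split_ifs with ha
  · exact isProbabilityMeasure_gammaMeasure ha one_pos
  · infer_instance

theorem ae_nonneg_besselTimeLaw (a : ℝ) : ∀ᵐ τ ∂(besselTimeLaw a), 0 ≤ τ := by
  rw [besselTimeLaw]
  split_ifs
  · exact ae_nonneg_gammaMeasure a 1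
  · simp [ae_dirac_eq]

theorem integral_exp_neg_mul_besselTimeLaw {a c : ℝ} (ha : 0 ≤ a) (hc : 0 ≤ c) :
    ∫ τ, Real.exp (-(c * τ)) ∂(besselTimeLaw a) = (1 + c) ^ (-a) := by
  rcases ha.eq_or_lt with rfl | ha
  · simp [besselTimeLaw]
  · rw [besselTimeLaw, if_pos ha, integral_exp_neg_mul_gammaMeasure ha hc]

theorem ofReal_sobolevSymbol_hasTemperateGrowth (d : ℕ) (s : ℝ) :
    (fun ξ : Rd d => (sobolevSymbol d s ξ : ℂ)).HasTemperateGrowth :=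
  Complex.ofRealCLM.hasTemperateGrowth.comp (sobolevSymbol_hasTemperateGrowth d s)

theorem averageSymbol_gaussianMixture_besselTimeLaw (d : ℕ) {s : ℝ} (hs : s ≤ 0) :
    averageSymbol (gaussianMixture (Rd d) (besselTimeLaw (-s / 2))) (fun _ => 1) =
      fun ξ => (sobolevSymbol d s ξ : ℂ) := by
  funext ξ
  rw [averageSymbol_one_eq_charFun, charFun_gaussianMixture (ae_nonneg_besselTimeLaw _),
    integral_exp_neg_mul_besselTimeLaw (by linarith) (by positivity), sobolevSymbol, norm_smul,
    Real.norm_of_nonneg (by positivity)]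
  ring_nf

/-- The operator `(I - Δ/2)^(s/2)`, `s ≤ 0`, on `L^r`: the average of translates over a Gaussian
mixture with a gamma distributed time. -/
noncomputable def besselPotential (d : ℕ) (s : ℝ) (r : ℝ≥0∞) [Fact (1 ≤ r)] [Fact (r ≠ ∞)] :
    Lp ℂ r (volume : Measure (Rd d)) →L[ℂ] Lp ℂ r (volume : Measure (Rd d)) :=
  shiftAverage (integrable_const (μ := gaussianMixture (Rd d) (besselTimeLaw (-s / 2))) (1 : ℂ))

variable {d : ℕ} {r : ℝ≥0∞} [Fact (1 ≤ r)] [Fact (r ≠ ∞)]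

theorem norm_besselPotential_apply_le (s : ℝ) (f : Lp ℂ r (volume : Measure (Rd d))) :
    ‖besselPotential d s r f‖ ≤ ‖f‖ := by
  simpa [besselPotential] using norm_shiftAverage_apply_le
    (integrable_const (μ := gaussianMixture (Rd d) (besselTimeLaw (-s / 2))) (1 : ℂ)) f

theorem fracPower_toTemperedDistribution {s : ℝ} (hs : s ≤ 0)
    (f : Lp ℂ r (volume : Measure (Rd d))) :
    fracPower d s (f : 𝓢'(Rd d, ℂ)) = (besselPotential d s r f : 𝓢'(Rd d, ℂ)) := by
  have hsymbol := averageSymbol_gaussianMixture_besselTimeLaw d hs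
  rw [besselPotential, toTemperedDistribution_shiftAverage, hsymbol, fracPower]
  rw [hsymbol]
  exact ofReal_sobolevSymbol_hasTemperateGrowth d s

end Bessel

/-! ### Mollification -/

section Mollify

open FourierTransform RealInnerProductSpace

theorem fourierInv_compSubConst {E : Type*} [NormedAddCommGroup E] [InnerProductSpace ℝ E]
    [MeasurableSpace E] [BorelSpace E] [FiniteDimensional ℝ E] (x : E) (φ : 𝓢(E, ℂ)) (ξ : E) :
    (𝓕⁻ (φ.compSubConstCLM ℂ x) : 𝓢(E, ℂ)) ξ =
      Real.fourierChar ⟪x, ξ⟫ • (𝓕⁻ φ : 𝓢(E, ℂ)) ξ := by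
  simp only [SchwartzMap.fourierInv_coe, Real.fourierInv_eq, SchwartzMap.compSubConstCLM_apply]
  rw [← integral_add_left_eq_self (μ := volume) _ x]
  simp only [add_sub_cancel_left, inner_add_left, AddChar.map_add_eq_mul, mul_smul]
  simp only [Circle.smul_def, integral_smul]

variable {d : ℕ}

/-- The fractional power `(I - Δ/2)^(s/2)` on Schwartz functions, transposed to `fracPower`. -/
noncomputable def schwartzPower (d : ℕ) (s : ℝ) (φ : 𝓢(Rd d, ℂ)) : 𝓢(Rd d, ℂ) :=
  𝓕 (SchwartzMap.smulLeftCLM ℂ (fun ξ => (sobolevSymbol d s ξ : ℂ)) (𝓕⁻ φ))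

theorem fracPower_apply (s : ℝ) (u : 𝓢'(Rd d, ℂ)) (φ : 𝓢(Rd d, ℂ)) :
    fracPower d s u φ = u (schwartzPower d s φ) := rfl

theorem schwartzPower_compSubConst (s : ℝ) (x : Rd d) (φ : 𝓢(Rd d, ℂ)) :
    schwartzPower d s (φ.compSubConstCLM ℂ x) = (schwartzPower d s φ).compSubConstCLM ℂ x := by
  ext z
  simp only [SchwartzMap.compSubConstCLM_apply, schwartzPower, SchwartzMap.fourier_coe,
    Real.fourier_eq]
  congr 1; funext ξ
  simp only [SchwartzMap.smulLeftCLM_apply_apply (ofReal_sobolevSymbol_hasTemperateGrowth d s),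
    fourierInv_compSubConst]
  rw [smul_comm _ (Real.fourierChar ⟪x, ξ⟫), smul_smul, ← AddChar.map_add_eq_mul, inner_sub_right,
    real_inner_comm ξ x, neg_sub, neg_add_eq_sub]

theorem averageSymbol_schwartzPower (s : ℝ) (φ : 𝓢(Rd d, ℂ)) :
    averageSymbol volume (schwartzPower d s φ) =
      averageSymbol volume φ * fun ξ => (sobolevSymbol d s ξ : ℂ) := by
  funext ξ
  rw [averageSymbol_volume, averageSymbol_volume, schwartzPower,
    FourierTransform.fourierInv_fourier_eq, Pi.mul_apply,
    SchwartzMap.smulLeftCLM_apply_apply (ofReal_sobolevSymbol_hasTemperateGrowth d s), smul_eq_mul,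
    mul_comm]

variable {r : ℝ≥0∞} [Fact (1 ≤ r)]

theorem Sobolev.apply_compSubConst {s : ℝ} (w : Sobolev d s r) (φ : 𝓢(Rd d, ℂ)) (x : Rd d) :
    Sobolev.toDistribution d s r w (φ.compSubConstCLM ℂ x) =
      lpPair (schwartzPower d (-s) φ) (DomAddAct.mk x +ᵥ w.toLp) := by
  rw [← fracPower_neg_fracPower d s (Sobolev.toDistribution d s r w), Sobolev.toLp_spec,
    fracPower_apply, schwartzPower_compSubConst, toTemperedDistribution_apply_eq_lpPair,
    lpPair_compSubConst]

variable [Fact (r ≠ ∞)]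

theorem toTemperedDistribution_shiftAverage_schwartzPower (s : ℝ) (φ : 𝓢(Rd d, ℂ))
    (f : Lp ℂ r (volume : Measure (Rd d))) :
    (shiftAverage ((schwartzPower d s φ).integrable (μ := volume)) f : 𝓢'(Rd d, ℂ)) =
      fracPower d s (shiftAverage (φ.integrable (μ := volume)) f : 𝓢'(Rd d, ℂ)) := by
  rw [toTemperedDistribution_shiftAverage _ (averageSymbol_volume_hasTemperateGrowth _),
    toTemperedDistribution_shiftAverage _ (averageSymbol_volume_hasTemperateGrowth _),
    averageSymbol_schwartzPower, fracPower,
    TemperedDistribution.fourierMultiplierCLM_fourierMultiplierCLM_apply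
      (averageSymbol_volume_hasTemperateGrowth _) (ofReal_sobolevSymbol_hasTemperateGrowth d s)]

theorem besselPotential_shiftAverage_schwartzPower {s : ℝ} (hs : s ≤ 0) (φ : 𝓢(Rd d, ℂ))
    (f : Lp ℂ r (volume : Measure (Rd d))) :
    besselPotential d s r (shiftAverage ((schwartzPower d (-s) φ).integrable (μ := volume)) f) =
      shiftAverage (φ.integrable (μ := volume)) f := by
  apply Sobolev.toTemperedDistribution_injective
  simp only [Lp.toTemperedDistributionCLM_apply]
  rw [← fracPower_toTemperedDistribution hs, toTemperedDistribution_shiftAverage_schwartzPower]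
  simpa only [neg_neg] using fracPower_neg_fracPower d (-s)
    (shiftAverage (φ.integrable (μ := volume)) f : 𝓢'(Rd d, ℂ))

end Mollify

section Mollifier

variable {E : Type*} [NormedAddCommGroup E] [NormedSpace ℝ E] [HasContDiffBump E]
  [FiniteDimensional ℝ E] [MeasurableSpace E] [BorelSpace E]

/-- The mollifier of a bump function, that is, the bump function normalized to integral `1`, as a
complex valued Schwartz function. -/
noncomputable def mollifier (μ : Measure E) [IsLocallyFiniteMeasure μ] [μ.IsOpenPosMeasure]
    (b : ContDiffBump (0 : E)) : 𝓢(E, ℂ) :=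
  HasCompactSupport.toSchwartzMap (f := Complex.ofRealCLM ∘ b.normed μ)
    (b.hasCompactSupport_normed.comp_left rfl)
    (Complex.ofRealCLM.contDiff.comp b.contDiff_normed)

variable {μ : Measure E} [μ.IsAddHaarMeasure] {r : ℝ≥0∞} [Fact (1 ≤ r)]

theorem mollifier_apply (b : ContDiffBump (0 : E)) (x : E) :
    mollifier μ b x = (b.normed μ x : ℂ) := rfl

theorem integral_mollifier (b : ContDiffBump (0 : E)) : ∫ x, mollifier μ b x ∂μ = 1 := by
  simp only [mollifier_apply, integral_complex_ofReal, b.integral_normed, Complex.ofReal_one]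

variable [Fact (r ≠ ∞)]

theorem norm_shiftAverage_mollifier_apply_le (b : ContDiffBump (0 : E)) (f : Lp ℂ r μ) :
    ‖shiftAverage ((mollifier μ b).integrable (μ := μ)) f‖ ≤ ‖f‖ := by
  refine (norm_shiftAverage_apply_le _ f).trans_eq ?_
  simp only [mollifier_apply, Complex.norm_real, Real.norm_of_nonneg (b.nonneg_normed _),
    b.integral_normed, one_mul]

theorem norm_shiftAverage_mollifier_sub_le (b : ContDiffBump (0 : E)) (f : Lp ℂ r μ) {ε : ℝ}
    (hε : ∀ y : E, ‖y‖ < b.rOut → ‖(DomAddAct.mk y +ᵥ f) - f‖ ≤ ε) :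
    ‖shiftAverage ((mollifier μ b).integrable (μ := μ)) f - f‖ ≤ ε := by
  have hsub : shiftAverage ((mollifier μ b).integrable (μ := μ)) f - f =
      ∫ y, mollifier μ b y • ((DomAddAct.mk y +ᵥ f) - f) ∂μ := by
    simp only [smul_sub]
    rw [integral_sub (integrable_smul_shift (mollifier μ b).integrable f)
      ((mollifier μ b).integrable.smul_const f), integral_smul_const, integral_mollifier, one_smul,
      shiftAverage_apply]
  have hle : ∀ y, ‖mollifier μ b y • ((DomAddAct.mk y +ᵥ f) - f)‖ ≤ b.normed μ y * ε := by
    intro y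
    rw [norm_smul, mollifier_apply, Complex.norm_real, Real.norm_of_nonneg (b.nonneg_normed y)]
    by_cases hy : ‖y‖ < b.rOut
    · exact mul_le_mul_of_nonneg_left (hε y hy) (b.nonneg_normed y)
    · have hzero : b.normed μ y = 0 := by
        rw [← Function.notMem_support, b.support_normed_eq]
        simpa using hy
      simp [hzero]
  calc _ ≤ ∫ y, b.normed μ y * ε ∂μ := by
        rw [hsub]
        exact norm_integral_le_of_norm_le (b.integrable_normed.mul_const ε) (ae_of_all _ hle)
    _ = ε := by rw [integral_mul_const, b.integral_normed, one_mul]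

theorem tendsto_shiftAverage_mollifier {ι : Type*} {l : Filter ι} {b : ι → ContDiffBump (0 : E)}
    (hb : Tendsto (fun n => (b n).rOut) l (𝓝 0)) (f : Lp ℂ r μ) :
    Tendsto (fun n => shiftAverage ((mollifier μ (b n)).integrable (μ := μ)) f) l (𝓝 f) := by
  rw [Metric.tendsto_nhds]
  intro ε hε
  have hshift : Tendsto (fun y : E => DomAddAct.mk y +ᵥ f) (𝓝 0) (𝓝 f) := by
    simpa using (continuous_shift f).tendsto 0
  obtain ⟨δ, hδ, hball⟩ := Metric.eventually_nhds_iff.1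
    (hshift.eventually (Metric.ball_mem_nhds f (half_pos hε)))
  filter_upwards [hb.eventually (gt_mem_nhds hδ)] with n hn
  rw [dist_eq_norm]
  refine (norm_shiftAverage_mollifier_sub_le (b n) f fun y hy => ?_).trans_lt (half_lt_self hε)
  rw [← dist_eq_norm]
  exact (hball (by simpa using hy.trans hn)).le

end Mollifier

/-! ### Spatial cutoff -/

section Cutoff

variable {E : Type*} [NormedAddCommGroup E]

/-- A continuous cutoff function, equal to `1` on the ball of radius `R` and to `0` outside the
ball of radius `R + 1`. -/
noncomputable def cutoff (R : ℝ) (x : E) : ℝ := max 0 (min 1 (R + 1 - ‖x‖))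

theorem continuous_cutoff (R : ℝ) : Continuous (cutoff R : E → ℝ) := by
  unfold cutoff; fun_prop

theorem cutoff_nonneg (R : ℝ) (x : E) : 0 ≤ cutoff R x := le_max_left _ _

theorem cutoff_le_one (R : ℝ) (x : E) : cutoff R x ≤ 1 :=
  max_le zero_le_one (min_le_left _ _)

theorem cutoff_eq_one {R : ℝ} {x : E} (h : ‖x‖ ≤ R) : cutoff R x = 1 := by
  rw [cutoff, min_eq_left (by linarith), max_eq_right zero_le_one]

theorem cutoff_eq_zero {R : ℝ} {x : E} (h : R + 1 ≤ ‖x‖) : cutoff R x = 0 :=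
  max_eq_left ((min_le_right _ _).trans (by linarith))

theorem norm_ofReal_cutoff_le (R : ℝ) (x : E) : ‖(cutoff R x : ℂ)‖ ≤ 1 := by
  rw [Complex.norm_real, Real.norm_of_nonneg (cutoff_nonneg R x)]
  exact cutoff_le_one R x

variable [MeasurableSpace E] [OpensMeasurableSpace E]

theorem memLp_ofReal_cutoff (μ : Measure E) (R : ℝ) :
    MemLp (fun x : E => (cutoff R x : ℂ)) ∞ μ :=
  memLp_top_of_bound (by have := continuous_cutoff (E := E) R; fun_prop) 1
    (ae_of_all _ (norm_ofReal_cutoff_le R))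

variable {μ : Measure E} {r : ℝ≥0∞} [Fact (1 ≤ r)]

/-- Multiplication by the cutoff function on `L^r`. -/
noncomputable def cutoffLp (R : ℝ) : Lp ℂ r μ →L[ℂ] Lp ℂ r μ :=
  (ContinuousLinearMap.mul ℂ ℂ).holderL μ ∞ r r ((memLp_ofReal_cutoff μ R).toLp _)

theorem cutoffLp_ae_eq (R : ℝ) (f : Lp ℂ r μ) :
    cutoffLp R f =ᵐ[μ] fun x => (cutoff R x : ℂ) * f x := by
  filter_upwards [(ContinuousLinearMap.mul ℂ ℂ).coeFn_holder (r := r)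
      ((memLp_ofReal_cutoff μ R).toLp _) f,
    (memLp_ofReal_cutoff μ R).coeFn_toLp] with x hholder hcutoff
  rw [ContinuousLinearMap.mul_apply', hcutoff] at hholder
  exact hholder

theorem norm_cutoffLp_apply_le (R : ℝ) (f : Lp ℂ r μ) : ‖cutoffLp R f‖ ≤ ‖f‖ := by
  refine Lp.norm_le_norm_of_ae_le ?_
  filter_upwards [cutoffLp_ae_eq R f] with x hx
  rw [hx, norm_mul]
  exact mul_le_of_le_one_left (norm_nonneg _) (norm_ofReal_cutoff_le R x)

theorem lipschitzWith_cutoffLp (R : ℝ) : LipschitzWith 1 (cutoffLp R : Lp ℂ r μ → Lp ℂ r μ) :=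
  AddMonoidHomClass.lipschitz_of_bound_nnnorm _ 1 fun f => by
    rw [one_mul]
    exact norm_cutoffLp_apply_le R f

theorem cutoffLp_eq_self {R : ℝ} {f : Lp ℂ r μ} (hf : ∀ᵐ x ∂μ, R < ‖x‖ → f x = 0) :
    cutoffLp R f = f := by
  ext1
  filter_upwards [cutoffLp_ae_eq R f, hf] with x hcutoff hzero
  rw [hcutoff]
  rcases le_or_gt ‖x‖ R with hx | hx
  · rw [cutoff_eq_one hx, Complex.ofReal_one, one_mul]
  · rw [hzero hx, mul_zero]

end Cutoff

section BoundedSupport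

variable {E F : Type*} [NormedAddCommGroup E] [ProperSpace E] [MeasurableSpace E] [BorelSpace E]
  [NormedAddCommGroup F] [NormedSpace ℝ F] {μ : Measure E} [μ.Regular] {r : ℝ≥0∞} [Fact (1 ≤ r)]
  [hr : Fact (r ≠ ∞)]

theorem mem_closure_setOf_ae_eq_zero_of_lt_norm (f : Lp F r μ) :
    f ∈ closure {g : Lp F r μ | ∃ R, ∀ᵐ x ∂μ, R < ‖x‖ → g x = 0} := by
  rw [EMetric.mem_closure_iff]
  intro ε hε
  obtain ⟨δ, hδ, hδε⟩ := exists_between hε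
  obtain ⟨g, hgc, hfg, -, hg⟩ := (Lp.memLp f).exists_hasCompactSupport_eLpNorm_sub_le hr.out hδ.ne'
  obtain ⟨R, hR⟩ := hgc.isCompact.isBounded.subset_closedBall 0
  refine ⟨hg.toLp g, ⟨R, ?_⟩, ?_⟩
  · filter_upwards [hg.coeFn_toLp] with x hx hRx
    rw [hx]
    refine image_eq_zero_of_notMem_tsupport fun hx => hRx.not_ge ?_
    simpa using hR hx
  · rw [Lp.edist_def]
    refine (eLpNorm_congr_ae ?_).trans_le hfg |>.trans_lt hδε
    exact EventuallyEq.rfl.sub hg.coeFn_toLp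

theorem tendsto_cutoffLp (f : Lp ℂ r μ) : Tendsto (fun R => cutoffLp R f) atTop (𝓝 f) := by
  refine ((LipschitzWith.uniformEquicontinuous _ 1
    lipschitzWith_cutoffLp).equicontinuous f).tendsto_of_mem_closure (f := id)
    (continuousAt_id.mono_left inf_le_left) ?_ (mem_closure_setOf_ae_eq_zero_of_lt_norm f)
  rintro g ⟨R₀, hg⟩
  refine tendsto_const_nhds.congr' ?_
  filter_upwards [eventually_ge_atTop R₀] with R hR
  exact (cutoffLp_eq_self (hg.mono fun x hx h => hx (hR.trans_lt h))).symm

end BoundedSupport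

theorem tendstoUniformly_comp_of_lipschitzWith {ι X α β : Type*} [TopologicalSpace X]
    [CompactSpace X] [PseudoMetricSpace α] [PseudoMetricSpace β] {S : ι → α → β} {K : ℝ≥0}
    (hS : ∀ i, LipschitzWith K (S i)) {f : X → α} (hf : Continuous f) {l : Filter ι} {g : X → β}
    (hg : ∀ x, Tendsto (fun i => S i (f x)) l (𝓝 (g x))) :
    TendstoUniformly (fun i x => S i (f x)) g l := by
  have hequi : Equicontinuous fun i x => S i (f x) := fun x =>
    Metric.equicontinuousAt_of_continuity_modulus (fun y => K * dist (f x) (f y))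
      (by simpa using (by fun_prop : Continuous fun y => K * dist (f x) (f y)).tendsto x) _
      (Eventually.of_forall fun y i => (hS i).dist_le_mul (f x) (f y))
  exact UniformFun.tendsto_iff_tendstoUniformly.1
    ((hequi.tendsto_uniformFun_iff_pi l g).2 (tendsto_pi_nhds.2 hg))

/-! ### Regularization in `C([0,T]; H^s_r)` -/

section Regularization

variable {d : ℕ} {s : ℝ} {r : ℝ≥0∞} [Fact (1 ≤ r)]

namespace Sobolev

theorem norm_def (w : Sobolev d s r) : ‖w‖ = ‖w.toLp‖ := rfl

theorem toLp_sub (w w' : Sobolev d s r) : (w - w').toLp = w.toLp - w'.toLp :=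
  map_sub (toLpHom d s r) w w'

theorem isometry_toLp : Isometry (toLp : Sobolev d s r → _) :=
  Isometry.of_dist_eq fun w w' => by rw [dist_eq_norm, dist_eq_norm, norm_def, toLp_sub]

/-- The mollification `x ↦ ∫ ρ(y - x) w(y) dy` of `w ∈ H^s_r`, where `ρ` is the mollifier of `b`. -/
noncomputable def mollify (b : ContDiffBump (0 : Rd d)) (w : Sobolev d s r) (x : Rd d) : ℝ :=
  (toDistribution d s r w ((mollifier volume b).compSubConstCLM ℂ x)).re

theorem ofReal_mollify (b : ContDiffBump (0 : Rd d)) (w : Sobolev d s r) (x : Rd d) :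
    (mollify b w x : ℂ) = toDistribution d s r w ((mollifier volume b).compSubConstCLM ℂ x) := by
  have him : (toDistribution d s r w ((mollifier volume b).compSubConstCLM ℂ x)).im = 0 :=
    w.2.1 _ fun y => by
      rw [SchwartzMap.compSubConstCLM_apply, mollifier_apply, Complex.ofReal_im]
  exact Complex.ext rfl him.symm

variable [Fact (r ≠ ∞)]

theorem continuous_mollify (b : ContDiffBump (0 : Rd d)) :
    Continuous fun p : Sobolev d s r × Rd d => mollify b p.1 p.2 := by
  have htoLp := isometry_toLp (d := d) (s := s) (r := r) |>.continuous
  simp only [mollify, apply_compSubConst]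
  fun_prop

/-- The mollification of `w ∈ H^s_r` as an element of `L^r`. The weight `(I - Δ/2)^(-s/2) ρ`
averages the function `(I - Δ/2)^(s/2) w ∈ L^r`, because `w` itself need not be a function. -/
noncomputable def mollifyLp (b : ContDiffBump (0 : Rd d)) (w : Sobolev d s r) :
    Lp ℂ r (volume : Measure (Rd d)) :=
  shiftAverage ((schwartzPower d (-s) (mollifier volume b)).integrable (μ := volume)) w.toLp

theorem mollifyLp_ae_eq (b : ContDiffBump (0 : Rd d)) (w : Sobolev d s r) :
    mollifyLp b w =ᵐ[volume] fun x => (mollify b w x : ℂ) := by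
  simp only [ofReal_mollify, apply_compSubConst]
  exact shiftAverage_ae_eq_lpPair_shift _ _

theorem continuous_mollifyLp (b : ContDiffBump (0 : Rd d)) :
    Continuous (mollifyLp b : Sobolev d s r → _) :=
  (shiftAverage _).continuous.comp isometry_toLp.continuous

theorem besselPotential_mollifyLp (hs : s ≤ 0) (b : ContDiffBump (0 : Rd d)) (w : Sobolev d s r) :
    besselPotential d s r (mollifyLp b w) =
      shiftAverage ((mollifier volume b).integrable (μ := volume)) w.toLp :=
  besselPotential_shiftAverage_schwartzPower hs _ _

/-- A real function in `L^r` as an element of `H^s_r`, `s ≤ 0`. -/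
noncomputable def ofLp (hs : s ≤ 0) (f : Lp ℂ r (volume : Measure (Rd d)))
    (hf : ∀ᵐ x, (f x).im = 0) : Sobolev d s r :=
  ⟨(f : 𝓢'(Rd d, ℂ)), fun φ hφ => by
    have hreal : (f : 𝓢'(Rd d, ℂ)) φ = ∫ x, (((φ x).re * (f x).re : ℝ) : ℂ) := by
      rw [Lp.toTemperedDistribution_apply]
      refine integral_congr_ae ?_
      filter_upwards [hf] with x hx
      rw [smul_eq_mul]
      apply Complex.ext <;> simp [hφ x, hx]
    rw [hreal, integral_complex_ofReal, Complex.ofReal_im],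
    besselPotential d s r f, fracPower_toTemperedDistribution hs f⟩

theorem toDistribution_ofLp (hs : s ≤ 0) (f : Lp ℂ r (volume : Measure (Rd d)))
    (hf : ∀ᵐ x, (f x).im = 0) :
    toDistribution d s r (ofLp hs f hf) = (f : 𝓢'(Rd d, ℂ)) := rfl

theorem toLp_ofLp (hs : s ≤ 0) (f : Lp ℂ r (volume : Measure (Rd d)))
    (hf : ∀ᵐ x, (f x).im = 0) : (ofLp hs f hf).toLp = besselPotential d s r f := by
  apply toTemperedDistribution_injective
  simp only [Lp.toTemperedDistributionCLM_apply]
  rw [← toLp_spec, toDistribution_ofLp, fracPower_toTemperedDistribution hs]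

theorem cutoffLp_mollifyLp_ae_eq (b : ContDiffBump (0 : Rd d)) (R : ℝ) (w : Sobolev d s r) :
    cutoffLp R (mollifyLp b w) =ᵐ[volume] fun x => ((cutoff R x * mollify b w x : ℝ) : ℂ) := by
  filter_upwards [cutoffLp_ae_eq R (mollifyLp b w), mollifyLp_ae_eq b w] with x hcutoff hmollify
  rw [hcutoff, hmollify, Complex.ofReal_mul]

theorem ae_im_cutoffLp_mollifyLp (b : ContDiffBump (0 : Rd d)) (R : ℝ) (w : Sobolev d s r) :
    ∀ᵐ x, (cutoffLp R (mollifyLp b w) x).im = 0 := by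
  filter_upwards [cutoffLp_mollifyLp_ae_eq b R w] with x hx
  rw [hx, Complex.ofReal_im]

/-- The product of the cutoff function and the mollification of `w`, in `H^s_r`. -/
noncomputable def regularize (hs : s ≤ 0) (b : ContDiffBump (0 : Rd d)) (R : ℝ)
    (w : Sobolev d s r) : Sobolev d s r :=
  ofLp hs (cutoffLp R (mollifyLp b w)) (ae_im_cutoffLp_mollifyLp b R w)

theorem toDistribution_regularize (hs : s ≤ 0) (b : ContDiffBump (0 : Rd d)) (R : ℝ)
    (w : Sobolev d s r) (φ : 𝓢(Rd d, ℂ)) :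
    toDistribution d s r (regularize hs b R w) φ =
      ∫ x, φ x * ((cutoff R x * mollify b w x : ℝ) : ℂ) := by
  rw [regularize, toDistribution_ofLp, Lp.toTemperedDistribution_apply]
  refine integral_congr_ae ?_
  filter_upwards [cutoffLp_mollifyLp_ae_eq b R w] with x hx
  rw [hx, smul_eq_mul]

theorem continuous_regularize (hs : s ≤ 0) (b : ContDiffBump (0 : Rd d)) (R : ℝ) :
    Continuous (regularize hs b R : Sobolev d s r → Sobolev d s r) := by
  rw [isometry_toLp.isUniformInducing.isInducing.continuous_iff]
  have hcomp : toLp ∘ (regularize hs b R : Sobolev d s r → Sobolev d s r) =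
      fun w => besselPotential d s r (cutoffLp R (mollifyLp b w)) :=
    funext fun w => toLp_ofLp hs _ _
  rw [hcomp]
  exact (besselPotential d s r).continuous.comp
    ((cutoffLp R).continuous.comp (continuous_mollifyLp b))

theorem norm_regularize_sub_le (hs : s ≤ 0) (b : ContDiffBump (0 : Rd d)) (R : ℝ)
    (w : Sobolev d s r) :
    ‖regularize hs b R w - w‖ ≤ ‖cutoffLp R (mollifyLp b w) - mollifyLp b w‖ +
      ‖shiftAverage ((mollifier volume b).integrable (μ := volume)) w.toLp - w.toLp‖ := by
  have hsplit : (regularize hs b R w - w).toLp =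
      besselPotential d s r (cutoffLp R (mollifyLp b w) - mollifyLp b w) +
        (shiftAverage ((mollifier volume b).integrable (μ := volume)) w.toLp - w.toLp) := by
    rw [toLp_sub, regularize, toLp_ofLp, map_sub, besselPotential_mollifyLp hs,
      sub_add_sub_cancel]
  rw [norm_def, hsplit]
  exact (norm_add_le _ _).trans (add_le_add_left (norm_besselPotential_apply_le s _) _)

end Sobolev

variable {T : ℝ}

/-- The function of compact support given by mollification and cutoff; it vanishes at times outside
`[0,T]`. -/
noncomputable def regularizeFun (b : ContDiffBump (0 : Rd d)) (R : ℝ)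
    (u : C(Icc (0 : ℝ) T, SobolevVec d s r)) (t : ℝ) (x : Rd d) : Rd d :=
  if ht : t ∈ Icc (0 : ℝ) T then
    WithLp.toLp 2 fun i => cutoff R x * Sobolev.mollify b (u ⟨t, ht⟩ i) x
  else 0

theorem regularizeFun_apply (b : ContDiffBump (0 : Rd d)) (R : ℝ)
    (u : C(Icc (0 : ℝ) T, SobolevVec d s r)) {t : ℝ} (ht : t ∈ Icc (0 : ℝ) T) (x : Rd d)
    (i : Fin d) :
    regularizeFun b R u t x i = cutoff R x * Sobolev.mollify b (u ⟨t, ht⟩ i) x := by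
  rw [regularizeFun, dif_pos ht]

variable [Fact (r ≠ ∞)]

theorem continuousOn_uncurry_regularizeFun (b : ContDiffBump (0 : Rd d)) (R : ℝ)
    (u : C(Icc (0 : ℝ) T, SobolevVec d s r)) :
    ContinuousOn (Function.uncurry (regularizeFun b R u)) (Icc 0 T ×ˢ univ) := by
  have htime : Continuous fun p : ↥(Icc (0 : ℝ) T ×ˢ (univ : Set (Rd d))) =>
      (⟨p.1.1, p.2.1⟩ : Icc (0 : ℝ) T) := by fun_prop
  have hcutoff := continuous_cutoff (E := Rd d) R
  have hmollify (i : Fin d) : Continuous fun p : ↥(Icc (0 : ℝ) T ×ˢ (univ : Set (Rd d))) =>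
      Sobolev.mollify b (u ⟨p.1.1, p.2.1⟩ i) p.1.2 :=
    (Sobolev.continuous_mollify b).comp
      (((continuous_apply i).comp (u.continuous.comp htime)).prodMk (by fun_prop))
  rw [continuousOn_iff_continuous_domRestrict]
  refine Continuous.congr (f := fun p => WithLp.toLp 2 fun i =>
    cutoff R p.1.2 * Sobolev.mollify b (u ⟨p.1.1, p.2.1⟩ i) p.1.2) (by fun_prop) fun p => ?_
  ext i
  exact (regularizeFun_apply b R u p.2.1 p.1.2 i).symm

theorem isContinuousCompactSupport_regularizeFun (b : ContDiffBump (0 : Rd d)) (R : ℝ)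
    (u : C(Icc (0 : ℝ) T, SobolevVec d s r)) :
    IsContinuousCompactSupport T (regularizeFun b R u) := by
  refine ⟨continuousOn_uncurry_regularizeFun b R u, Metric.closedBall 0 (R + 1),
    isCompact_closedBall _ _, fun t ht x hx => ?_⟩
  ext i
  have hx : R + 1 ≤ ‖x‖ := (not_le.1 fun h => hx (by simpa using h)).le
  rw [regularizeFun_apply b R u ht, cutoff_eq_zero hx, zero_mul, PiLp.zero_apply]

/-- The regularization of an element of `C([0,T]; H^s_r)`, by mollification and cutoff. -/
noncomputable def regularizeMap (hs : s ≤ 0) (b : ContDiffBump (0 : Rd d)) (R : ℝ)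
    (u : C(Icc (0 : ℝ) T, SobolevVec d s r)) : C(Icc (0 : ℝ) T, SobolevVec d s r) where
  toFun t i := Sobolev.regularize hs b R (u t i)
  continuous_toFun := continuous_pi fun i =>
    (Sobolev.continuous_regularize hs b R).comp ((continuous_apply i).comp u.continuous)

theorem isGivenBy_regularizeMap (hs : s ≤ 0) (b : ContDiffBump (0 : Rd d)) (R : ℝ)
    (u : C(Icc (0 : ℝ) T, SobolevVec d s r)) :
    IsGivenBy (regularizeMap hs b R u) (regularizeFun b R u) := by
  refine ae_of_all _ fun t ht i φ _ => ?_
  simp only [regularizeFun_apply b R u ht]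
  exact Sobolev.toDistribution_regularize hs b R (u ⟨t, ht⟩ i) φ

theorem exists_forall_norm_cutoffLp_mollifyLp_sub_le (b : ContDiffBump (0 : Rd d))
    (u : C(Icc (0 : ℝ) T, SobolevVec d s r)) (R₀ : ℝ) {ε : ℝ} (hε : 0 < ε) :
    ∃ R ≥ R₀, ∀ i t,
      ‖cutoffLp R (Sobolev.mollifyLp b (u t i)) - Sobolev.mollifyLp b (u t i)‖ ≤ ε := by
  have hcont (i : Fin d) : Continuous fun t => Sobolev.mollifyLp b (u t i) :=
    (Sobolev.continuous_mollifyLp b).comp ((continuous_apply i).comp u.continuous)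
  have hclose : ∀ᶠ R in atTop, ∀ i t,
      dist (Sobolev.mollifyLp b (u t i)) (cutoffLp R (Sobolev.mollifyLp b (u t i))) < ε :=
    eventually_all.2 fun i => Metric.tendstoUniformly_iff.1
      (tendstoUniformly_comp_of_lipschitzWith lipschitzWith_cutoffLp (hcont i)
        fun t => tendsto_cutoffLp _) ε hε
  obtain ⟨R, hR, hle⟩ := (hclose.and (eventually_ge_atTop R₀)).exists
  refine ⟨R, hle, fun i t => ?_⟩
  rw [← dist_eq_norm, dist_comm]
  exact (hR i t).le

theorem eventually_forall_norm_shiftAverage_mollifier_sub_lt {b : ℕ → ContDiffBump (0 : Rd d)}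
    (hb : Tendsto (fun n => (b n).rOut) atTop (𝓝 0)) (u : C(Icc (0 : ℝ) T, SobolevVec d s r))
    {ε : ℝ} (hε : 0 < ε) :
    ∀ᶠ n in atTop, ∀ i t, ‖shiftAverage ((mollifier volume (b n)).integrable (μ := volume))
      (u t i).toLp - (u t i).toLp‖ < ε := by
  have hlip (n : ℕ) : LipschitzWith 1
      (shiftAverage (r := r) ((mollifier volume (b n)).integrable (μ := volume))) :=
    AddMonoidHomClass.lipschitz_of_bound_nnnorm _ 1 fun f => by
      rw [one_mul]
      exact norm_shiftAverage_mollifier_apply_le (b n) f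
  refine eventually_all.2 fun i => ?_
  simp only [← dist_eq_norm, dist_comm _ (u _ i).toLp]
  exact Metric.tendstoUniformly_iff.1 (tendstoUniformly_comp_of_lipschitzWith hlip
    (Sobolev.isometry_toLp.continuous.comp ((continuous_apply i).comp u.continuous))
    fun t => tendsto_shiftAverage_mollifier hb _) ε hε

theorem exists_tendsto_regularizeMap (hs : s ≤ 0) {b : ℕ → ContDiffBump (0 : Rd d)}
    (hb : Tendsto (fun n => (b n).rOut) atTop (𝓝 0)) (u : C(Icc (0 : ℝ) T, SobolevVec d s r)) :
    ∃ R : ℕ → ℝ, Tendsto R atTop atTop ∧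
      Tendsto (fun n => regularizeMap hs (b n) (R n) u) atTop (𝓝 u) := by
  choose R hR hcutoff using fun n : ℕ => exists_forall_norm_cutoffLp_mollifyLp_sub_le (b n) u n
    (Nat.one_div_pos_of_nat (α := ℝ) (n := n))
  refine ⟨R, tendsto_atTop_mono hR tendsto_natCast_atTop_atTop, Metric.tendsto_nhds.2 ?_⟩
  intro ε hε
  filter_upwards [eventually_forall_norm_shiftAverage_mollifier_sub_lt hb u (half_pos hε),
    (tendsto_one_div_add_atTop_nhds_zero_nat (𝕜 := ℝ)).eventually (gt_mem_nhds (half_pos hε))]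
    with n hmollifier hn
  have hnorm (i : Fin d) (t : Icc (0 : ℝ) T) :
      ‖Sobolev.regularize hs (b n) (R n) (u t i) - u t i‖ < ε := by
    linarith [Sobolev.norm_regularize_sub_le hs (b n) (R n) (u t i), hcutoff n i t, hmollifier i t]
  rw [ContinuousMap.dist_lt_iff hε]
  exact fun t => (dist_pi_lt_iff hε).2 fun i => by
    rw [dist_eq_norm]
    exact hnorm i t

end Regularization

section BumpSequence

variable {E : Type*} [NormedAddCommGroup E]

/-- A sequence of bump functions at the origin, with radii tending to `0` and comparable inner and
outer radii. -/
noncomputable def bumpSeq (E : Type*) [NormedAddCommGroup E] (n : ℕ) : ContDiffBump (0 : E) where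
  rIn := 1 / (2 * ((n : ℝ) + 1))
  rOut := 1 / ((n : ℝ) + 1)
  rIn_pos := by positivity
  rIn_lt_rOut := by
    apply one_div_lt_one_div_of_lt <;> linarith [n.cast_nonneg (α := ℝ)]

theorem tendsto_bumpSeq_rOut (E : Type*) [NormedAddCommGroup E] :
    Tendsto (fun n => (bumpSeq E n).rOut) atTop (𝓝 0) :=
  tendsto_one_div_add_atTop_nhds_zero_nat

theorem bumpSeq_rOut_le_one (n : ℕ) : (bumpSeq E n).rOut ≤ 1 :=
  div_le_one_of_le₀ (by linarith [n.cast_nonneg (α := ℝ)]) (by positivity)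

theorem bumpSeq_rOut_le (n : ℕ) : (bumpSeq E n).rOut ≤ 2 * (bumpSeq E n).rIn := by
  simp only [bumpSeq]
  apply le_of_eq
  field_simp

end BumpSequence

/-! ### Continuous processes and laws of Brownian motion -/

section ProductMeasure

theorem absolutelyContinuous_pi_fin {n : ℕ} {α : Fin n → Type*} [∀ i, MeasurableSpace (α i)]
    {μ ν : ∀ i, Measure (α i)} [∀ i, SigmaFinite (μ i)] [∀ i, SigmaFinite (ν i)]
    (h : ∀ i, μ i ≪ ν i) : Measure.pi μ ≪ Measure.pi ν := by
  induction n with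
  | zero => rw [Measure.pi_of_empty, Measure.pi_of_empty]
  | succ n ih =>
    rw [← (measurePreserving_piFinSuccAbove μ 0).symm.map_eq,
      ← (measurePreserving_piFinSuccAbove ν 0).symm.map_eq]
    exact ((h 0).prod (ih fun j => h (Fin.succAbove 0 j))).map (MeasurableEquiv.measurable _)

theorem absolutelyContinuous_pi {ι : Type*} [Fintype ι] {α : ι → Type*}
    [∀ i, MeasurableSpace (α i)] {μ ν : ∀ i, Measure (α i)} [∀ i, SigmaFinite (μ i)]
    [∀ i, SigmaFinite (ν i)] (h : ∀ i, μ i ≪ ν i) : Measure.pi μ ≪ Measure.pi ν := by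
  have e := (Fintype.equivFin ι).symm
  rw [← (measurePreserving_piCongrLeft μ e).map_eq, ← (measurePreserving_piCongrLeft ν e).map_eq]
  exact (absolutelyContinuous_pi_fin fun i => h (e i)).map (MeasurableEquiv.measurable _)

end ProductMeasure

section Processes

variable {Ω : Type*} [MeasurableSpace Ω] {P : Measure Ω}

theorem ae_forall_eq_of_continuousOn {S F : Type*} [TopologicalSpace S]
    [SecondCountableTopology S] [TopologicalSpace F] [T2Space F] {s : Set S} {X Y : S → Ω → F}
    (hX : ∀ᵐ ω ∂P, ContinuousOn (X · ω) s) (hY : ∀ᵐ ω ∂P, ContinuousOn (Y · ω) s)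
    (h : ∀ t ∈ s, ∀ᵐ ω ∂P, X t ω = Y t ω) : ∀ᵐ ω ∂P, ∀ t ∈ s, X t ω = Y t ω := by
  obtain ⟨D, hDc, hD⟩ := TopologicalSpace.exists_countable_dense s
  have hDeq : ∀ᵐ ω ∂P, ∀ t ∈ D, X t ω = Y t ω := (ae_ball_iff hDc).mpr fun t _ => h t t.2
  filter_upwards [hX, hY, hDeq] with ω hXω hYω hω t ht
  exact congrFun (Continuous.ext_on hD hXω.domRestrict hYω.domRestrict hω) ⟨t, ht⟩

theorem exists_continuous_of_ae_continuous {S F : Type*} [TopologicalSpace S] [TopologicalSpace F]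
    [MeasurableSpace F] [Nonempty F] {X : S → Ω → F} (hXm : ∀ t, Measurable (X t))
    (hX : ∀ᵐ ω ∂P, Continuous (X · ω)) :
    ∃ Y : S → Ω → F, (∀ t, Measurable (Y t)) ∧ (∀ ω, Continuous (Y · ω)) ∧
      ∀ᵐ ω ∂P, ∀ t, X t ω = Y t ω := by
  classical
  obtain ⟨N, hN, hNm, hNP⟩ := exists_measurable_superset_of_null (ae_iff.mp hX)
  refine ⟨fun t => N.piecewise (fun _ => Classical.arbitrary F) (X t),
    fun t => Measurable.piecewise hNm measurable_const (hXm t), fun ω => ?_, ?_⟩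
  · by_cases hω : ω ∈ N
    · simpa only [piecewise_eq_of_mem _ _ _ hω] using continuous_const
    · simpa only [piecewise_eq_of_notMem _ _ _ hω] using not_not.mp fun h => hω (hN h)
  · filter_upwards [measure_eq_zero_iff_ae_notMem.mp hNP] with ω hω t
    rw [piecewise_eq_of_notMem _ _ _ hω]

theorem ae_ae_of_ae_prod_of_map_absolutelyContinuous {S E : Type*} [MeasurableSpace S]
    [MeasurableSpace E] [SFinite P] {m : Measure S} [SFinite m] {ν : Measure E} [SFinite ν]
    {X : S → Ω → E} (hX : Measurable (Function.uncurry X)) (hac : ∀ᵐ q ∂m, P.map (X q) ≪ ν)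
    {p : S × E → Prop} (hp : ∀ᵐ z ∂(m.prod ν), p z) : ∀ᵐ ω ∂P, ∀ᵐ q ∂m, p (q, X q ω) := by
  obtain ⟨N, hN, hNm, hN0⟩ := exists_measurable_superset_of_null (ae_iff.mp hp)
  have hNX : ∀ᵐ q ∂m, ∀ᵐ ω ∂P, (q, X q ω) ∉ N := by
    filter_upwards [Measure.measure_ae_null_of_prod_null hN0, hac] with q hq hacq
    exact ae_of_ae_map (hX.comp measurable_prodMk_left).aemeasurable
      (measure_eq_zero_iff_ae_notMem.mp (hacq hq))
  have hmeas : MeasurableSet {z : S × Ω | (z.1, X z.1 z.2) ∉ N} :=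
    ((measurable_fst.prodMk hX) hNm).compl
  filter_upwards [(Measure.ae_ae_comm hmeas).mp hNX] with ω hω
  exact hω.mono fun q hq => not_not.mp fun h => hq (hN h)

theorem TendstoUCP.tendstoInMeasure {ι F : Type*} [PseudoMetricSpace F] {T : ℝ}
    {X : ι → ℝ → Ω → F} {a : Filter ι} {Y : ℝ → Ω → F} (h : TendstoUCP P T X a Y) {t : ℝ}
    (ht : t ∈ Icc 0 T) : TendstoInMeasure P (fun n => X n t) a (Y t) := by
  rw [tendstoInMeasure_iff_dist]
  intro η hη
  exact tendsto_of_tendsto_of_tendsto_of_le_of_le tendsto_const_nhds (h η hη)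
    (fun _ => zero_le) (fun n => measure_mono fun ω hω => ⟨t, ht, hω⟩)

theorem TendstoUCP.ae_eq_of_forall_ae_tendsto {F : Type*} [MetricSpace F] {T : ℝ}
    {X : ℕ → ℝ → Ω → F} {Y Z : ℝ → Ω → F} (h : TendstoUCP P T X atTop Y)
    (hY : ∀ᵐ ω ∂P, ContinuousOn (Y · ω) (Icc 0 T)) (hZ : ∀ᵐ ω ∂P, ContinuousOn (Z · ω) (Icc 0 T))
    (hXZ : ∀ t ∈ Icc 0 T, ∀ᵐ ω ∂P, Tendsto (X · t ω) atTop (𝓝 (Z t ω))) :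
    ∀ᵐ ω ∂P, ∀ t ∈ Icc 0 T, Y t ω = Z t ω := by
  refine ae_forall_eq_of_continuousOn hY hZ fun t ht => ?_
  obtain ⟨ns, hns, hXY⟩ := (h.tendstoInMeasure ht).exists_seq_tendsto_ae
  filter_upwards [hXY, hXZ t ht] with ω hXYω hXZω
  exact tendsto_nhds_unique hXYω (hXZω.comp hns.tendsto_atTop)

end Processes

namespace IsBrownianVec

variable {Ω : Type*} [MeasurableSpace Ω] {P : Measure Ω} {d : ℕ} {W V : ℝ≥0 → Ω → Rd d}

theorem measurable_apply (hW : IsBrownianVec W P) (t : ℝ≥0) (i : Fin d) :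
    Measurable fun ω => W t ω i :=
  (EuclideanSpace.proj (𝕜 := ℝ) i).measurable.comp (hW.measurable t)

theorem ae_continuous (hW : IsBrownianVec W P) : ∀ᵐ ω ∂P, Continuous (W · ω) := by
  filter_upwards [ae_all_iff.mpr fun i => (hW.isBrownianReal i).cont] with ω hω
  exact (PiLp.continuous_toLp 2 _).comp (continuous_pi hω)

theorem congr (hW : IsBrownianVec W P) (hV : ∀ t, Measurable (V t))
    (h : ∀ᵐ ω ∂P, ∀ t, W t ω = V t ω) : IsBrownianVec V P where
  measurable := hV
  isBrownianReal i := by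
    refine ⟨(hW.isBrownianReal i).toIsPreBrownianReal.congr fun t => ?_, ?_⟩
    · filter_upwards [h] with ω hω
      rw [hω t]
    · filter_upwards [h, (hW.isBrownianReal i).cont] with ω hω hcont
      simpa only [hω] using hcont
  independent := by
    refine hW.independent.congr fun i => ?_
    filter_upwards [h] with ω hω
    funext t
    rw [hω t]

theorem exists_continuous_modification (hW : IsBrownianVec W P) :
    ∃ V : ℝ≥0 → Ω → Rd d, IsBrownianVec V P ∧ (∀ ω, Continuous (V · ω)) ∧
      ∀ᵐ ω ∂P, ∀ t, W t ω = V t ω := by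
  obtain ⟨V, hVm, hVc, hWV⟩ := exists_continuous_of_ae_continuous hW.measurable hW.ae_continuous
  exact ⟨V, hW.congr hVm hWV, hVc, hWV⟩

theorem map_absolutelyContinuous (hW : IsBrownianVec W P) {q : ℝ≥0} (hq : q ≠ 0) :
    P.map (W q) ≪ volume := by
  have hpi : P.map (fun ω i => W q ω i) = Measure.pi fun _ => gaussianReal 0 q := by
    have hind : iIndepFun (fun (i : Fin d) ω => W q ω i) P :=
      hW.independent.comp (fun _ p => p q) fun _ => measurable_pi_apply q
    rw [hind.map_fun_eq_pi_map fun i => (hW.measurable_apply q i).aemeasurable]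
    congr with i : 1
    exact ((hW.isBrownianReal i).hasLaw_eval q).map_eq
  have hmap : P.map (W q) = (P.map fun ω i => W q ω i).map (WithLp.toLp 2) := by
    rw [Measure.map_map (by fun_prop) (measurable_pi_lambda _ (hW.measurable_apply q))]
    rfl
  rw [hmap, hpi, ← (PiLp.volume_preserving_toLp (Fin d)).map_eq]
  exact (absolutelyContinuous_pi fun _ => gaussianReal_absolutelyContinuous 0 hq).map
    (by fun_prop)

theorem ae_ae_of_ae_prod [SFinite P] (hW : IsBrownianVec W P) {T : ℝ} {p : ℝ × Rd d → Prop}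
    (hp : ∀ᵐ z ∂((volume : Measure ℝ).restrict (Ioc 0 T)).prod volume, p z) :
    ∀ᵐ ω ∂P, ∀ᵐ q ∂(volume : Measure ℝ).restrict (Ioc 0 T), p (q, W q.toNNReal ω) := by
  obtain ⟨V, hV, hVc, hWV⟩ := hW.exists_continuous_modification
  have hpV : ∀ᵐ ω ∂P, ∀ᵐ q ∂(volume : Measure ℝ).restrict (Ioc 0 T), p (q, V q.toNNReal ω) := by
    refine ae_ae_of_ae_prod_of_map_absolutelyContinuous
      (measurable_uncurry_of_continuous_of_measurable
        (fun ω => (hVc ω).comp continuous_real_toNNReal) fun q => hV.measurable _) ?_ hp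
    filter_upwards [ae_restrict_mem measurableSet_Ioc] with q hq
    exact hV.map_absolutelyContinuous (Real.toNNReal_pos.mpr hq.1).ne'
  filter_upwards [hpV, hWV] with ω hω hWVω
  simpa only [hWVω] using hω

end IsBrownianVec

/-! ### Time averages of processes with correlations of short range -/

section ShortRange

variable {Ω : Type*} [MeasurableSpace Ω] {P : Measure Ω}

theorem integral_norm_mul_le_of_integral_sq_le {X Y : Ω → ℝ} (hX : MemLp X 2 P) (hY : MemLp Y 2 P)
    {K : ℝ} (hXK : ∫ ω, X ω ^ 2 ∂P ≤ K) (hYK : ∫ ω, Y ω ^ 2 ∂P ≤ K) :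
    ∫ ω, ‖X ω * Y ω‖ ∂P ≤ K := by
  have hamgm (ω : Ω) : ‖X ω * Y ω‖ ≤ 2⁻¹ * (X ω ^ 2 + Y ω ^ 2) := by
    rw [norm_mul, ← sq_abs (X ω), ← sq_abs (Y ω), Real.norm_eq_abs, Real.norm_eq_abs]
    linarith [two_mul_le_add_sq |X ω| |Y ω|]
  calc ∫ ω, ‖X ω * Y ω‖ ∂P ≤ ∫ ω, 2⁻¹ * (X ω ^ 2 + Y ω ^ 2) ∂P :=
        integral_mono (hX.integrable_mul hY).norm
          ((hX.integrable_sq.add hY.integrable_sq).const_mul _) hamgm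
    _ = 2⁻¹ * (∫ ω, X ω ^ 2 ∂P + ∫ ω, Y ω ^ 2 ∂P) := by
        rw [integral_const_mul, integral_add hX.integrable_sq hY.integrable_sq]
    _ ≤ K := by linarith

theorem integrable_prod_mul_of_integral_sq_le [SFinite P] {S : Type*} [MeasurableSpace S]
    {m : Measure S} [IsFiniteMeasure m] {Z : S → Ω → ℝ} (hZ : Measurable (Function.uncurry Z))
    {K : ℝ} (hL2 : ∀ s, MemLp (Z s) 2 P) (hK : ∀ s, ∫ ω, Z s ω ^ 2 ∂P ≤ K) :
    Integrable (fun p : (S × S) × Ω => Z p.1.1 p.2 * Z p.1.2 p.2) ((m.prod m).prod P) := by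
  have hmeas : Measurable fun p : (S × S) × Ω => Z p.1.1 p.2 * Z p.1.2 p.2 :=
    (hZ.comp ((measurable_fst.comp measurable_fst).prodMk measurable_snd)).mul
      (hZ.comp ((measurable_snd.comp measurable_fst).prodMk measurable_snd))
  refine (integrable_prod_iff hmeas.aestronglyMeasurable).2
    ⟨ae_of_all _ fun p => (hL2 p.1).integrable_mul (hL2 p.2), ?_⟩
  refine Integrable.of_bound hmeas.norm.stronglyMeasurable.integral_prod_right.aestronglyMeasurable
    K (ae_of_all _ fun p => ?_)
  rw [Real.norm_of_nonneg (integral_nonneg fun ω => norm_nonneg _)]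
  exact integral_norm_mul_le_of_integral_sq_le (hL2 p.1) (hL2 p.2) (hK p.1) (hK p.2)

theorem prod_setOf_abs_sub_lt_le {m : Measure ℝ} [SFinite m] (hm : m ≤ volume) (ε : ℝ) :
    (m.prod m) {p | |p.1 - p.2| < ε} ≤ ENNReal.ofReal (2 * ε) * m univ := by
  rw [Measure.prod_apply (measurableSet_lt (by fun_prop) measurable_const), ← lintegral_const]
  refine lintegral_mono fun s => ?_
  have hball : Prod.mk s ⁻¹' {p : ℝ × ℝ | |p.1 - p.2| < ε} = Metric.ball s ε := by
    ext s'
    rw [Metric.mem_ball', Real.dist_eq]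
    rfl
  rw [hball, ← Real.volume_ball s ε]
  exact hm _

theorem tendstoInMeasure_zero_of_integral_sq_le [IsFiniteMeasure P] {ι : Type*} {l : Filter ι}
    {V : ι → Ω → ℝ} {c : ι → ℝ} (hV : ∀ᶠ n in l, Integrable (fun ω => V n ω ^ 2) P ∧
      ∫ ω, V n ω ^ 2 ∂P ≤ c n) (hc : Tendsto c l (𝓝 0)) :
    TendstoInMeasure P V l fun _ => 0 := by
  rw [tendstoInMeasure_iff_measureReal_norm]
  intro η hη
  refine tendsto_of_tendsto_of_tendsto_of_le_of_le' tendsto_const_nhds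
    (by simpa using hc.div_const (η ^ 2)) (Eventually.of_forall fun _ => measureReal_nonneg) ?_
  filter_upwards [hV] with n hn
  have hset : {ω | η ≤ ‖V n ω - 0‖} = {ω | η ^ 2 ≤ V n ω ^ 2} := by
    ext ω
    rw [mem_ofPred_eq, mem_ofPred_eq, sub_zero, Real.norm_eq_abs, ← sq_abs (V n ω),
      sq_le_sq₀ hη.le (abs_nonneg _)]
  rw [hset, le_div_iff₀' (by positivity)]
  exact (mul_meas_ge_le_integral_of_nonneg (ae_of_all _ fun ω => sq_nonneg _) hn.1 _).trans hn.2

variable {m : Measure ℝ} [IsFiniteMeasure m] {Z : ℝ → Ω → ℝ}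

theorem integral_sq_integral_le_of_integral_mul_eq_zero [SFinite P] (hm : m ≤ volume)
    (hZ : Measurable (Function.uncurry Z)) {K ε : ℝ} (hε : 0 ≤ ε)
    (hL2 : ∀ s, MemLp (Z s) 2 P) (hK : ∀ s, ∫ ω, Z s ω ^ 2 ∂P ≤ K)
    (horth : ∀ᵐ p ∂m.prod m, ε ≤ |p.1 - p.2| → ∫ ω, Z p.1 ω * Z p.2 ω ∂P = 0) :
    Integrable (fun ω => (∫ s, Z s ω ∂m) ^ 2) P ∧
      ∫ ω, (∫ s, Z s ω ∂m) ^ 2 ∂P ≤ 2 * ε * m.real univ * K := by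
  have hK0 : 0 ≤ K := (integral_nonneg fun ω => sq_nonneg _).trans (hK 0)
  have hint := integrable_prod_mul_of_integral_sq_le (m := m) hZ hL2 hK
  have hband : MeasurableSet {p : ℝ × ℝ | |p.1 - p.2| < ε} :=
    measurableSet_lt (by fun_prop) measurable_const
  have hcorr : ∀ᵐ p ∂m.prod m, ∫ ω, Z p.1 ω * Z p.2 ω ∂P ≤
      {p : ℝ × ℝ | |p.1 - p.2| < ε}.indicator (fun _ => K) p := by
    filter_upwards [horth] with p hp
    by_cases h : |p.1 - p.2| < ε
    · rw [indicator_of_mem (mem_ofPred_eq ▸ h)]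
      exact (Real.le_norm_self _).trans ((norm_integral_le_integral_norm _).trans
        (integral_norm_mul_le_of_integral_sq_le (hL2 p.1) (hL2 p.2) (hK p.1) (hK p.2)))
    · rw [indicator_of_notMem (by exact h), hp (not_lt.mp h)]
  have hsq (ω : Ω) : (∫ s, Z s ω ∂m) ^ 2 = ∫ p, Z p.1 ω * Z p.2 ω ∂m.prod m := by
    rw [sq, integral_prod_mul (fun s => Z s ω) (fun s => Z s ω)]
  simp only [hsq]
  refine ⟨hint.integral_prod_right, ?_⟩
  calc ∫ ω, ∫ p, Z p.1 ω * Z p.2 ω ∂m.prod m ∂P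
      = ∫ p, ∫ ω, Z p.1 ω * Z p.2 ω ∂P ∂m.prod m := (integral_integral_swap hint).symm
    _ ≤ ∫ p, {p : ℝ × ℝ | |p.1 - p.2| < ε}.indicator (fun _ => K) p ∂m.prod m :=
        integral_mono_ae hint.integral_prod_left ((integrable_const K).indicator hband) hcorr
    _ = (m.prod m).real {p | |p.1 - p.2| < ε} * K := by
        rw [integral_indicator hband, setIntegral_const, smul_eq_mul]
    _ ≤ 2 * ε * m.real univ * K := by
        gcongr
        refine (ENNReal.toReal_mono (by finiteness) (prod_setOf_abs_sub_lt_le hm ε)).trans_eq ?_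
        rw [ENNReal.toReal_mul, ENNReal.toReal_ofReal (by positivity), measureReal_def]

theorem tendstoInMeasure_integral_of_integral_mul_eq_zero [IsFiniteMeasure P] (hm : m ≤ volume)
    {Z : ℝ → ℝ → Ω → ℝ} {K : ℝ} (hZ : ∀ ε, 0 < ε → Measurable (Function.uncurry (Z ε)))
    (hL2 : ∀ ε s, 0 < ε → MemLp (Z ε s) 2 P) (hK : ∀ ε s, 0 < ε → ∫ ω, Z ε s ω ^ 2 ∂P ≤ K)
    (horth : ∀ ε, 0 < ε → ∀ᵐ p ∂m.prod m, ε ≤ |p.1 - p.2| →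
      ∫ ω, Z ε p.1 ω * Z ε p.2 ω ∂P = 0) :
    TendstoInMeasure P (fun ε ω => ∫ s, Z ε s ω ∂m) (𝓝[>] 0) fun _ => 0 := by
  have hlim : Tendsto (fun ε : ℝ => 2 * ε * m.real univ * K) (𝓝[>] 0) (𝓝 0) := by
    have h : Tendsto (fun ε : ℝ => 2 * ε * m.real univ * K) (𝓝 0)
        (𝓝 (2 * 0 * m.real univ * K)) := Continuous.tendsto (by fun_prop) 0
    simp only [mul_zero, zero_mul] at h
    exact h.mono_left nhdsWithin_le_nhds
  refine tendstoInMeasure_zero_of_integral_sq_le ?_ hlim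
  filter_upwards [self_mem_nhdsWithin] with ε hε
  exact integral_sq_integral_le_of_integral_mul_eq_zero hm (hZ ε hε) (le_of_lt hε)
    (hL2 ε · hε) (hK ε · hε) (horth ε hε)

end ShortRange

/-! ### The covariation of Brownian motion -/

section Increment

variable {Ω : Type*}

/-- The increment `X_{a+e} - X_a`, the building block of the covariation by regularization. -/
def increment (X : ℝ≥0 → Ω → ℝ) (a e : ℝ≥0) (ω : Ω) : ℝ := X (a + e) ω - X a ω

variable [MeasurableSpace Ω] {P : Measure Ω} {X Y : ℝ≥0 → Ω → ℝ}

theorem isPreBrownianReal_increment (hX : IsPreBrownianReal X P) (a : ℝ≥0) :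
    IsPreBrownianReal (increment X a) P :=
  hX.shift a

theorem memLp_eval_of_isPreBrownianReal (hX : IsPreBrownianReal X P) (t : ℝ≥0) {p : ℝ≥0∞}
    (hp : p ≠ ∞) : MemLp (X t) p P :=
  (hX.isGaussianProcess.hasGaussianLaw_eval t).memLp hp

theorem integral_sq_of_isPreBrownianReal (hX : IsPreBrownianReal X P) (t : ℝ≥0) :
    ∫ ω, X t ω ^ 2 ∂P = t := by
  rw [← variance_of_integral_eq_zero (hX.aemeasurable t) (hX.integral_eval t),
    (hX.hasLaw_eval t).variance_eq, variance_id_gaussianReal]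

theorem integral_pow_gaussianReal (v : ℝ≥0) (n : ℕ) :
    ∫ x, x ^ n ∂(gaussianReal 0 v) = √v ^ n * ∫ x, x ^ n ∂(gaussianReal 0 1) := by
  have hscale := gaussianReal_map_const_mul (μ := 0) (v := 1) √v
  rw [mul_zero, mul_one, show NNReal.mk (√v ^ 2) (sq_nonneg _) = v from
    NNReal.eq (Real.sq_sqrt v.coe_nonneg)] at hscale
  rw [← hscale, integral_map (by fun_prop) (by fun_prop), ← integral_const_mul]
  simp only [mul_pow]

theorem integral_pow_four_of_isPreBrownianReal (hX : IsPreBrownianReal X P) (t : ℝ≥0) :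
    ∫ ω, X t ω ^ 4 ∂P = (t : ℝ) ^ 2 * ∫ x, x ^ 4 ∂(gaussianReal 0 1) := by
  have hsqrt : √(t : ℝ) ^ 4 = (t : ℝ) ^ 2 := by
    rw [show 4 = 2 * 2 from rfl, pow_mul, Real.sq_sqrt t.coe_nonneg]
  rw [← hsqrt, ← integral_pow_gaussianReal, ← (hX.hasLaw_eval t).map_eq,
    integral_map (hX.aemeasurable t) (by fun_prop)]

theorem indepFun_increment (hX : IsPreBrownianReal X P) {a e a' e' : ℝ≥0} (h : a + e ≤ a') :
    IndepFun (increment X a e) (increment X a' e') P := by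
  have hmono : Monotone ![a, a + e, a', a' + e'] := by
    refine Fin.monotone_iff_le_succ.2 fun i => ?_
    fin_cases i
    · exact le_add_of_nonneg_right zero_le
    · exact h
    · exact le_add_of_nonneg_right zero_le
  exact (hX.hasIndepIncrements 3 _ hmono).indepFun (i := 0) (j := 2) (by decide)

theorem memLp_increment_mul (hX : IsPreBrownianReal X P) (hY : IsPreBrownianReal Y P)
    (a e : ℝ≥0) {p : ℝ≥0∞} (hp : p ≠ ∞) :
    MemLp (fun ω => increment X a e ω * increment Y a e ω) p P := by
  have hholder : ENNReal.HolderTriple (2 * p) (2 * p) p := ⟨by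
    rw [ENNReal.mul_inv (by simp) (by simp), ← two_mul, ← mul_assoc,
      ENNReal.mul_inv_cancel two_ne_zero (by simp), one_mul]⟩
  have htop : 2 * p ≠ ∞ := ENNReal.mul_ne_top ENNReal.ofNat_ne_top hp
  exact (memLp_eval_of_isPreBrownianReal (isPreBrownianReal_increment hY a) e htop).mul'
    (memLp_eval_of_isPreBrownianReal (isPreBrownianReal_increment hX a) e htop)

theorem integral_sq_increment_mul_le (hX : IsPreBrownianReal X P) (hY : IsPreBrownianReal Y P)
    (a e : ℝ≥0) : ∫ ω, (increment X a e ω * increment Y a e ω) ^ 2 ∂P ≤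
      (e : ℝ) ^ 2 * ∫ x, x ^ 4 ∂(gaussianReal 0 1) := by
  have hsq {Z : ℝ≥0 → Ω → ℝ} (hZ : IsPreBrownianReal Z P) :
      MemLp (fun ω => increment Z a e ω ^ 2) 2 P := by
    simpa only [← sq] using memLp_increment_mul hZ hZ a e (p := 2) (by simp)
  have hfour {Z : ℝ≥0 → Ω → ℝ} (hZ : IsPreBrownianReal Z P) :
      ∫ ω, (increment Z a e ω ^ 2) ^ 2 ∂P ≤ (e : ℝ) ^ 2 * ∫ x, x ^ 4 ∂(gaussianReal 0 1) := by
    simp only [← pow_mul]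
    exact (integral_pow_four_of_isPreBrownianReal (isPreBrownianReal_increment hZ a) e).le
  refine le_trans (le_of_eq ?_)
    (integral_norm_mul_le_of_integral_sq_le (hsq hX) (hsq hY) (hfour hX) (hfour hY))
  simp only [← mul_pow, norm_pow, Real.norm_eq_abs, sq_abs]

theorem integral_increment_mul_self (hX : IsPreBrownianReal X P) (a e : ℝ≥0) :
    ∫ ω, increment X a e ω * increment X a e ω ∂P = e := by
  simp only [← sq]
  exact integral_sq_of_isPreBrownianReal (isPreBrownianReal_increment hX a) e

theorem integral_increment_mul_of_indepFun (hX : IsPreBrownianReal X P)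
    (hY : IsPreBrownianReal Y P) (hXY : IndepFun (fun ω t => X t ω) (fun ω t => Y t ω) P)
    (a e : ℝ≥0) : ∫ ω, increment X a e ω * increment Y a e ω ∂P = 0 := by
  have hind : IndepFun (increment X a e) (increment Y a e) P :=
    hXY.comp (φ := fun p : ℝ≥0 → ℝ => p (a + e) - p a) (ψ := fun p : ℝ≥0 → ℝ => p (a + e) - p a)
      (by fun_prop) (by fun_prop)
  rw [hind.integral_fun_mul_eq_mul_integral
    ((isPreBrownianReal_increment hX a).aemeasurable e).aestronglyMeasurable
    ((isPreBrownianReal_increment hY a).aemeasurable e).aestronglyMeasurable,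
    (isPreBrownianReal_increment hX a).integral_eval, zero_mul]

theorem covariance_increment_mul_self (hX : IsPreBrownianReal X P) {a e a' : ℝ≥0}
    (h : a + e ≤ a') : cov[fun ω => increment X a e ω * increment X a e ω,
      fun ω => increment X a' e ω * increment X a' e ω; P] = 0 :=
  ((indepFun_increment hX h).comp (φ := fun x => x * x) (ψ := fun x => x * x) (by fun_prop)
    (by fun_prop)).covariance_eq_zero (memLp_increment_mul hX hX a e (by simp))
    (memLp_increment_mul hX hX a' e (by simp))

theorem covariance_increment_mul_of_indepFun (hX : IsPreBrownianReal X P)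
    (hY : IsPreBrownianReal Y P) (hXY : IndepFun (fun ω t => X t ω) (fun ω t => Y t ω) P)
    {a e a' : ℝ≥0} (h : a + e ≤ a') : cov[fun ω => increment X a e ω * increment Y a e ω,
      fun ω => increment X a' e ω * increment Y a' e ω; P] = 0 := by
  have := hX.isGaussianProcess.isProbabilityMeasure
  have hm {Z : ℝ≥0 → Ω → ℝ} (hZ : IsPreBrownianReal Z P) (b : ℝ≥0) :
      AEStronglyMeasurable (increment Z b e) P :=
    ((isPreBrownianReal_increment hZ b).aemeasurable e).aestronglyMeasurable
  have hind : IndepFun (fun ω => increment X a e ω * increment X a' e ω)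
      (fun ω => increment Y a e ω * increment Y a' e ω) P :=
    hXY.comp (φ := fun p : ℝ≥0 → ℝ => (p (a + e) - p a) * (p (a' + e) - p a'))
      (ψ := fun p : ℝ≥0 → ℝ => (p (a + e) - p a) * (p (a' + e) - p a'))
      (by fun_prop) (by fun_prop)
  rw [covariance_eq_sub (memLp_increment_mul hX hY a e (by simp))
    (memLp_increment_mul hX hY a' e (by simp)), integral_increment_mul_of_indepFun hX hY hXY,
    zero_mul, sub_zero]
  calc ∫ ω, (increment X a e ω * increment Y a e ω) * (increment X a' e ω * increment Y a' e ω) ∂P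
      = ∫ ω, (increment X a e ω * increment X a' e ω) *
          (increment Y a e ω * increment Y a' e ω) ∂P := by simp only [mul_mul_mul_comm]
    _ = (∫ ω, increment X a e ω * increment X a' e ω ∂P) *
          ∫ ω, increment Y a e ω * increment Y a' e ω ∂P :=
        hind.integral_fun_mul_eq_mul_integral ((hm hX a).mul (hm hX a'))
          ((hm hY a).mul (hm hY a'))
    _ = 0 := by
        rw [(indepFun_increment hX h).integral_fun_mul_eq_mul_integral (hm hX a) (hm hX a'),
          (isPreBrownianReal_increment hX a).integral_eval, zero_mul, zero_mul]

end Increment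

section Covariation

variable {Ω : Type*}

/-- The integrand `e⁻¹ (X_{a+e} - X_a) (Y_{a+e} - Y_a)` of the covariation by regularization,
centered by its expectation `c`. -/
noncomputable def covariationError (X Y : ℝ≥0 → Ω → ℝ) (c : ℝ) (e a : ℝ≥0) (ω : Ω) : ℝ :=
  (e : ℝ)⁻¹ * (increment X a e ω * increment Y a e ω) - c

theorem integral_covariationError {X Y : ℝ≥0 → Ω → ℝ} {ω : Ω} (hX : Continuous (X · ω))
    (hY : Continuous (Y · ω)) (c : ℝ) {ε t : ℝ} (hε : 0 < ε) (ht : 0 ≤ t) :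
    ∫ s in Ioc 0 t, covariationError X Y c ε.toNNReal s.toNNReal ω =
      ε⁻¹ * (∫ s in (0 : ℝ)..t, (X (s + ε).toNNReal ω - X s.toNNReal ω) *
        (Y (s + ε).toNNReal ω - Y s.toNNReal ω)) - c * t := by
  have hcont : Continuous fun s : ℝ => (X (s + ε).toNNReal ω - X s.toNNReal ω) *
      (Y (s + ε).toNNReal ω - Y s.toNNReal ω) := by
    have hshift : Continuous fun s : ℝ => (s + ε).toNNReal := by fun_prop
    exact ((hX.comp hshift).sub (hX.comp continuous_real_toNNReal)).mul
      ((hY.comp hshift).sub (hY.comp continuous_real_toNNReal))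
  calc ∫ s in Ioc 0 t, covariationError X Y c ε.toNNReal s.toNNReal ω
      = ∫ s in Ioc 0 t, (ε⁻¹ * ((X (s + ε).toNNReal ω - X s.toNNReal ω) *
          (Y (s + ε).toNNReal ω - Y s.toNNReal ω)) - c) :=
        setIntegral_congr_fun measurableSet_Ioc fun s hs => by
          simp only [covariationError, increment, Real.toNNReal_add hs.1.le hε.le,
            Real.coe_toNNReal ε hε.le]
    _ = _ := by
        rw [← intervalIntegral.integral_of_le ht, intervalIntegral.integral_sub
          ((hcont.const_mul _).intervalIntegrable _ _) intervalIntegrable_const,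
          intervalIntegral.integral_const_mul, intervalIntegral.integral_const, sub_zero,
          smul_eq_mul, mul_comm t]

variable [MeasurableSpace Ω] {P : Measure Ω} {X Y : ℝ≥0 → Ω → ℝ} {c : ℝ}

theorem measurable_uncurry_covariationError (hXm : ∀ t, Measurable (X t))
    (hYm : ∀ t, Measurable (Y t)) (hXc : ∀ ω, Continuous (X · ω)) (hYc : ∀ ω, Continuous (Y · ω))
    (c : ℝ) (e : ℝ≥0) :
    Measurable (Function.uncurry fun (s : ℝ) ω => covariationError X Y c e s.toNNReal ω) := by
  refine measurable_uncurry_of_continuous_of_measurable (fun ω => ?_) fun s => ?_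
  · have hX := hXc ω
    have hY := hYc ω
    unfold covariationError increment
    fun_prop
  · unfold covariationError increment
    fun_prop

theorem memLp_covariationError (hX : IsPreBrownianReal X P) (hY : IsPreBrownianReal Y P)
    (c : ℝ) (e a : ℝ≥0) : MemLp (covariationError X Y c e a) 2 P :=
  have := hX.isGaussianProcess.isProbabilityMeasure
  ((memLp_increment_mul hX hY a e (by simp)).const_mul _).sub (memLp_const c)

theorem integral_inv_mul_increment_mul {e a : ℝ≥0} (he : e ≠ 0)
    (hc : ∫ ω, increment X a e ω * increment Y a e ω ∂P = c * e) :
    ∫ ω, (e : ℝ)⁻¹ * (increment X a e ω * increment Y a e ω) ∂P = c := by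
  have he' : (e : ℝ) ≠ 0 := NNReal.coe_ne_zero.2 he
  rw [integral_const_mul, hc]
  field_simp

theorem integral_sq_covariationError_le (hX : IsPreBrownianReal X P) (hY : IsPreBrownianReal Y P)
    {e a : ℝ≥0} (he : e ≠ 0) (hc : ∫ ω, increment X a e ω * increment Y a e ω ∂P = c * e) :
    ∫ ω, covariationError X Y c e a ω ^ 2 ∂P ≤ ∫ x, x ^ 4 ∂(gaussianReal 0 1) := by
  have := hX.isGaussianProcess.isProbabilityMeasure
  have he' : (e : ℝ) ≠ 0 := NNReal.coe_ne_zero.2 he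
  have hmeas : AEStronglyMeasurable
      (fun ω => (e : ℝ)⁻¹ * (increment X a e ω * increment Y a e ω)) P :=
    ((memLp_increment_mul hX hY a e (p := 2) (by simp)).const_mul _).aestronglyMeasurable
  calc ∫ ω, covariationError X Y c e a ω ^ 2 ∂P
      = Var[fun ω => (e : ℝ)⁻¹ * (increment X a e ω * increment Y a e ω); P] := by
        rw [variance_eq_integral hmeas.aemeasurable, integral_inv_mul_increment_mul he hc]
        rfl
    _ ≤ ∫ ω, ((e : ℝ)⁻¹ * (increment X a e ω * increment Y a e ω)) ^ 2 ∂P :=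
        variance_le_expectation_sq hmeas
    _ = (e : ℝ)⁻¹ ^ 2 * ∫ ω, (increment X a e ω * increment Y a e ω) ^ 2 ∂P := by
        simp only [mul_pow (e : ℝ)⁻¹, integral_const_mul]
    _ ≤ (e : ℝ)⁻¹ ^ 2 * ((e : ℝ) ^ 2 * ∫ x, x ^ 4 ∂(gaussianReal 0 1)) := by
        gcongr
        exact integral_sq_increment_mul_le hX hY a e
    _ = ∫ x, x ^ 4 ∂(gaussianReal 0 1) := by field_simp

theorem integral_covariationError_mul {e a a' : ℝ≥0} (he : e ≠ 0)
    (hc : ∀ a, ∫ ω, increment X a e ω * increment Y a e ω ∂P = c * e)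
    (hcov : cov[fun ω => increment X a e ω * increment Y a e ω,
      fun ω => increment X a' e ω * increment Y a' e ω; P] = 0) :
    ∫ ω, covariationError X Y c e a ω * covariationError X Y c e a' ω ∂P = 0 := by
  calc ∫ ω, covariationError X Y c e a ω * covariationError X Y c e a' ω ∂P
      = cov[fun ω => (e : ℝ)⁻¹ * (increment X a e ω * increment Y a e ω),
          fun ω => (e : ℝ)⁻¹ * (increment X a' e ω * increment Y a' e ω); P] := by
        rw [covariance, integral_inv_mul_increment_mul he (hc a),
          integral_inv_mul_increment_mul he (hc a')]
        rfl
    _ = 0 := by rw [covariance_const_mul_left, covariance_const_mul_right, hcov, mul_zero, mul_zero]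

theorem toNNReal_add_toNNReal_le_or {ε s s' : ℝ} (hε : 0 ≤ ε) (hs : 0 ≤ s) (hs' : 0 ≤ s')
    (h : ε ≤ |s - s'|) :
    s.toNNReal + ε.toNNReal ≤ s'.toNNReal ∨ s'.toNNReal + ε.toNNReal ≤ s.toNNReal := by
  rw [← Real.toNNReal_add hs hε, ← Real.toNNReal_add hs' hε]
  rcases le_abs.mp h with h | h
  · exact Or.inr (Real.toNNReal_le_toNNReal (by linarith))
  · exact Or.inl (Real.toNNReal_le_toNNReal (by linarith))

theorem tendstoInMeasure_covariation (hX : IsPreBrownianReal X P) (hY : IsPreBrownianReal Y P)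
    (hXm : ∀ t, Measurable (X t)) (hYm : ∀ t, Measurable (Y t)) (hXc : ∀ ω, Continuous (X · ω))
    (hYc : ∀ ω, Continuous (Y · ω))
    (hc : ∀ a e, ∫ ω, increment X a e ω * increment Y a e ω ∂P = c * e)
    (hcov : ∀ a e a', a + e ≤ a' → cov[fun ω => increment X a e ω * increment Y a e ω,
      fun ω => increment X a' e ω * increment Y a' e ω; P] = 0) {t : ℝ} (ht : 0 ≤ t) :
    TendstoInMeasure P (fun (ε : ℝ) ω => ε⁻¹ * ∫ s in (0 : ℝ)..t,
      (X (s + ε).toNNReal ω - X s.toNNReal ω) * (Y (s + ε).toNNReal ω - Y s.toNNReal ω))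
      (𝓝[>] 0) fun _ => c * t := by
  have := hX.isGaussianProcess.isProbabilityMeasure
  have he {ε : ℝ} (hε : 0 < ε) : ε.toNNReal ≠ 0 := (Real.toNNReal_pos.2 hε).ne'
  have herror : TendstoInMeasure P
      (fun (ε : ℝ) ω => ∫ s in Ioc 0 t, covariationError X Y c ε.toNNReal s.toNNReal ω)
      (𝓝[>] 0) fun _ => 0 := by
    refine tendstoInMeasure_integral_of_integral_mul_eq_zero Measure.restrict_le_self
      (fun ε _ => measurable_uncurry_covariationError hXm hYm hXc hYc c ε.toNNReal)
      (fun ε s _ => memLp_covariationError hX hY c _ _)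
      (fun ε s hε => integral_sq_covariationError_le hX hY (he hε) (hc _ _)) fun ε hε => ?_
    rw [Measure.prod_restrict]
    filter_upwards [ae_restrict_mem (measurableSet_Ioc.prod measurableSet_Ioc)] with p hp hsep
    refine integral_covariationError_mul (he hε) (hc · _) ?_
    rcases toNNReal_add_toNNReal_le_or hε.le hp.1.1.le hp.2.1.le hsep with h | h
    · exact hcov _ _ _ h
    · rw [covariance_comm]
      exact hcov _ _ _ h
  rw [tendstoInMeasure_iff_norm] at herror ⊢
  refine fun η hη => (herror η hη).congr' ?_
  filter_upwards [self_mem_nhdsWithin] with ε hε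
  simp only [integral_covariationError (hXc _) (hYc _) c hε ht, sub_zero]

end Covariation

section BrownianCovariation

variable {Ω : Type*} [MeasurableSpace Ω] {P : Measure Ω} {d : ℕ} {W : ℝ≥0 → Ω → Rd d}

theorem IsBrownianVec.tendstoInMeasure_covariation (hW : IsBrownianVec W P)
    (hWc : ∀ ω, Continuous (W · ω)) (i j : Fin d) {t : ℝ} (ht : 0 ≤ t) :
    TendstoInMeasure P (fun (ε : ℝ) ω => ε⁻¹ * ∫ s in (0 : ℝ)..t,
      (W (s + ε).toNNReal ω i - W s.toNNReal ω i) * (W (s + ε).toNNReal ω j - W s.toNNReal ω j))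
      (𝓝[>] 0) fun _ => (if i = j then 1 else 0) * t := by
  have hB (i : Fin d) : IsPreBrownianReal (fun t ω => W t ω i) P :=
    (hW.isBrownianReal i).toIsPreBrownianReal
  have hcont (i : Fin d) (ω : Ω) : Continuous fun t => W t ω i := by
    have := hWc ω
    fun_prop
  refine _root_.tendstoInMeasure_covariation (hB i) (hB j) (hW.measurable_apply · i)
    (hW.measurable_apply · j) (hcont i) (hcont j) (fun a e => ?_) (fun a e a' h => ?_) ht
  · split_ifs with hij
    · subst hij
      rw [integral_increment_mul_self (hB i), one_mul]
    · rw [integral_increment_mul_of_indepFun (hB i) (hB j) (hW.independent.indepFun hij), zero_mul]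
  · by_cases hij : i = j
    · subst hij
      exact covariance_increment_mul_self (hB i) h
    · exact covariance_increment_mul_of_indepFun (hB i) (hB j) (hW.independent.indepFun hij) h

theorem IsBrownianVec.covariation_eq (hW : IsBrownianVec W P) {T : ℝ} {i j : Fin d}
    {C : ContinuousProcess Ω T ℝ}
    (hC : IsCovariation P T (fun t ω => W t ω i) (fun t ω => W t ω j) C.val) :
    ∀ᵐ ω ∂P, ∀ t ∈ Icc 0 T, C.val t ω = (if i = j then 1 else 0) * t := by
  refine ae_forall_eq_of_continuousOn (ae_of_all _ C.continuousOn)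
    (ae_of_all _ fun _ => by fun_prop) fun t ht => ?_
  obtain ⟨V, hV, hVc, hWV⟩ := hW.exists_continuous_modification
  refine tendstoInMeasure_ae_unique ((hC.tendstoInMeasure ht).congr_left fun ε => ?_)
    (hV.tendstoInMeasure_covariation hVc i j ht.1)
  filter_upwards [hWV] with ω hω
  simp only [hω]

end BrownianCovariation

/-! ### The integral operator on continuous functions of compact support -/

section RiemannSum

variable {E : Type*} [NormedAddCommGroup E] [NormedSpace ℝ E] [CompleteSpace E] {f : ℝ → E}

theorem norm_sub_smul_sub_integral_le {a b ε : ℝ} (hab : a ≤ b)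
    (hf : IntervalIntegrable f volume a b) (hε : ∀ q ∈ Ioc a b, ‖f a - f q‖ ≤ ε) :
    ‖(b - a) • f a - ∫ q in a..b, f q‖ ≤ ε * (b - a) := by
  rw [← intervalIntegral.integral_const, ← intervalIntegral.integral_sub (by simp) hf,
    ← abs_of_nonneg (sub_nonneg.2 hab)]
  exact intervalIntegral.norm_integral_le_of_norm_le_const (by rwa [uIoc_of_le hab])

theorem norm_sum_sub_smul_sub_integral_le {a : ℕ → ℝ} {n : ℕ} {ε : ℝ} (ha : Monotone a)
    (hf : ∀ k < n, IntervalIntegrable f volume (a k) (a (k + 1)))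
    (hε : ∀ k < n, ∀ q ∈ Ioc (a k) (a (k + 1)), ‖f (a k) - f q‖ ≤ ε) :
    ‖∑ k ∈ Finset.range n, (a (k + 1) - a k) • f (a k) - ∫ q in a 0..a n, f q‖ ≤
      ε * (a n - a 0) := by
  rw [← intervalIntegral.sum_integral_adjacent_intervals hf, ← Finset.sum_sub_distrib,
    ← Finset.sum_range_sub a n, Finset.mul_sum]
  refine norm_sum_le_of_le _ fun k hk => ?_
  have hk := Finset.mem_range.1 hk
  exact norm_sub_smul_sub_integral_le (ha k.le_succ) (hf k hk) (hε k hk)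

theorem mul_div_mem_Icc {t x y : ℝ} (ht : 0 ≤ t) (hx : 0 ≤ x) (hxy : x ≤ y) :
    t * x / y ∈ Icc 0 t := by
  rw [mul_div_assoc]
  exact ⟨mul_nonneg ht (div_nonneg hx (hx.trans hxy)),
    mul_le_of_le_one_right ht (div_le_one_of_le₀ hxy (hx.trans hxy))⟩

theorem tendsto_riemannSum {t : ℝ} (ht : 0 ≤ t) (hf : ContinuousOn f (Icc 0 t)) :
    Tendsto (fun n : ℕ => ∑ k ∈ Finset.range n, (t * (k + 1) / n - t * k / n) • f (t * k / n))
      atTop (𝓝 (∫ q in (0 : ℝ)..t, f q)) := by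
  refine Metric.tendsto_nhds.2 fun ε hε => ?_
  obtain ⟨δ, hδ, hosc⟩ := Metric.uniformContinuousOn_iff.1
    (isCompact_Icc.uniformContinuousOn_of_continuous hf) (ε / (t + 1)) (by positivity)
  filter_upwards [(tendsto_const_div_atTop_nhds_zero_nat t).eventually (gt_mem_nhds hδ),
    eventually_gt_atTop 0] with n hmesh hn
  have hn0 : (n : ℝ) ≠ 0 := by exact_mod_cast hn.ne'
  have hmono : Monotone fun k : ℕ => t * k / n := fun j k hjk => by
    dsimp only
    gcongr
  have hmem {k : ℕ} (hk : k ≤ n) : t * k / n ∈ Icc 0 t :=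
    mul_div_mem_Icc ht k.cast_nonneg (by exact_mod_cast hk)
  have hsub {k : ℕ} (hk : k < n) : Icc (t * k / n) (t * (k + 1 : ℕ) / n) ⊆ Icc 0 t :=
    Icc_subset_Icc (hmem hk.le).1 (hmem hk).2
  have hsum := norm_sum_sub_smul_sub_integral_le (ε := ε / (t + 1)) (n := n) hmono
    (fun k hk => (hf.mono (uIcc_of_le (hmono k.le_succ) ▸ hsub hk)).intervalIntegrable)
    fun k hk q hq => by
      rw [← dist_eq_norm]
      refine (hosc _ (hmem hk.le) _ (hsub hk (Ioc_subset_Icc_self hq)) ?_).le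
      have hstep : t * (k + 1 : ℕ) / n = t * k / n + t / n := by push_cast; ring
      rw [dist_comm, Real.dist_eq, abs_of_pos (sub_pos.2 hq.1)]
      linarith [hq.2]
  simp only [Nat.cast_succ, CharP.cast_eq_zero, mul_zero, zero_div, sub_zero,
    mul_div_cancel_right₀ t hn0] at hsum
  rw [dist_eq_norm]
  refine hsum.trans_lt ?_
  rw [div_mul_eq_mul_div, div_lt_iff₀ (by positivity)]
  linarith

end RiemannSum

theorem isStieltjesIntegral_of_eqOn_linear {f c : ℝ → ℝ} {t m : ℝ} (ht : 0 ≤ t)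
    (hf : ContinuousOn f (Icc 0 t)) (hc : ∀ q ∈ Icc 0 t, c q = m * q) :
    IsStieltjesIntegral f c t (m * ∫ q in (0 : ℝ)..t, f q) := by
  refine ((tendsto_riemannSum ht hf).const_mul m).congr fun n => ?_
  rw [Finset.mul_sum]
  refine Finset.sum_congr rfl fun k hk => ?_
  have hk : (k : ℝ) + 1 ≤ n := by exact_mod_cast Finset.mem_range.1 hk
  rw [hc _ (mul_div_mem_Icc ht (by positivity) hk),
    hc _ (mul_div_mem_Icc ht k.cast_nonneg (by linarith)), smul_eq_mul]
  ring

theorem IsStieltjesIntegral.unique {f c : ℝ → ℝ} {t I J : ℝ} (hI : IsStieltjesIntegral f c t I)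
    (hJ : IsStieltjesIntegral f c t J) : I = J :=
  tendsto_nhds_unique (f := fun n : ℕ => ∑ k ∈ Finset.range n,
    f (t * k / n) * (c (t * (k + 1) / n) - c (t * k / n))) hI hJ

theorem intervalIntegral_apply {ι : Type*} [Fintype ι] {f : ℝ → EuclideanSpace ℝ ι} {a b : ℝ}
    (hf : IntervalIntegrable f volume a b) (i : ι) :
    (∫ q in a..b, f q) i = ∫ q in a..b, f q i :=
  ((EuclideanSpace.proj (𝕜 := ℝ) i : _ →L[ℝ] ℝ).intervalIntegral_comp_comm hf).symm

section PathIntegral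

variable {Ω : Type*} [MeasurableSpace Ω] {P : Measure Ω} {d : ℕ} {T : ℝ} {l : ℝ → Rd d → Rd d}

theorem IsContinuousCompactSupport.continuousOn_path (hl : IsContinuousCompactSupport T l)
    {p : ℝ≥0 → Rd d} (hp : Continuous p) :
    ContinuousOn (fun q : ℝ => l q (p q.toNNReal)) (Icc 0 T) :=
  hl.1.comp (continuousOn_id.prodMk (hp.comp continuous_real_toNNReal).continuousOn)
    fun _ hq => ⟨hq, mem_univ _⟩

theorem IsBrownianVec.integralAgainst_eq {W : ℝ≥0 → Ω → Rd d} (hW : IsBrownianVec W P)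
    {C : Fin d → Fin d → ContinuousProcess Ω T ℝ} (hC : IsFVCovariationMatrix P T W W C)
    (hl : IsContinuousCompactSupport T l) {X : ContinuousProcess Ω T (Rd d)}
    (hX : IsIntegralAgainst P W C l X) :
    ∀ᵐ ω ∂P, ∀ t ∈ Icc 0 T, X.val t ω = ∫ q in (0 : ℝ)..t, l q (W q.toNNReal ω) := by
  have hcov : ∀ᵐ ω ∂P, ∀ i j, ∀ t ∈ Icc 0 T, (C i j).val t ω = (if i = j then 1 else 0) * t :=
    ae_all_iff.2 fun i => ae_all_iff.2 fun j => hW.covariation_eq (hC i j).1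
  filter_upwards [hcov, hX, hW.ae_continuous] with ω hcovω hXω hWω t ht
  have hcont := (hl.continuousOn_path hWω).mono (Icc_subset_Icc_right ht.2)
  obtain ⟨I, hI, hXI⟩ := hXω t ht
  have hI_eq (i j : Fin d) :
      I i j = (if i = j then 1 else 0) * ∫ q in (0 : ℝ)..t, l q (W q.toNNReal ω) i :=
    (hI i j).unique (isStieltjesIntegral_of_eqOn_linear ht.1
      ((PiLp.continuous_apply 2 (fun _ => ℝ) i).comp_continuousOn hcont)
      fun q hq => hcovω i j q ⟨hq.1, hq.2.trans ht.2⟩)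
  ext j
  rw [hXI j, intervalIntegral_apply (hcont.intervalIntegrable_of_Icc ht.1)]
  simp only [hI_eq, ite_mul, one_mul, zero_mul, Finset.sum_ite_eq', Finset.mem_univ, if_true]

end PathIntegral

/-! ### Regularizations of locally bounded functions -/

theorem ae_prod_tendsto_of_ae_ae_tendsto {α β E : Type*} [MeasurableSpace α] [MeasurableSpace β]
    [NormedAddCommGroup E] {μ : Measure α} {ν : Measure β} [SFinite ν]
    {f : ℕ → α × β → E} {g : α × β → E} (hf : ∀ n, AEStronglyMeasurable (f n) (μ.prod ν))
    (hg : AEStronglyMeasurable g (μ.prod ν))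
    (h : ∀ᵐ x ∂μ, ∀ᵐ y ∂ν, Tendsto (fun n => f n (x, y)) atTop (𝓝 (g (x, y)))) :
    ∀ᵐ z ∂(μ.prod ν), Tendsto (fun n => f n z) atTop (𝓝 (g z)) := by
  have hmk : ∀ᵐ z ∂(μ.prod ν), Tendsto (fun n => f n z) atTop (𝓝 (g z)) ↔
      Tendsto (fun n => ‖(hf n).mk (f n) z - hg.mk g z‖) atTop (𝓝 0) := by
    filter_upwards [ae_all_iff.2 fun n => (hf n).ae_eq_mk, hg.ae_eq_mk] with z hfz hgz
    simp only [hfz, hgz, ← tendsto_iff_norm_sub_tendsto_zero]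
  have hmeas : MeasurableSet
      {z | Tendsto (fun n => ‖(hf n).mk (f n) z - hg.mk g z‖) atTop (𝓝 0)} :=
    measurableSet_tendsto _ fun n =>
      ((hf n).stronglyMeasurable_mk.sub hg.stronglyMeasurable_mk).norm.measurable
  have hlim : ∀ᵐ z ∂(μ.prod ν),
      Tendsto (fun n => ‖(hf n).mk (f n) z - hg.mk g z‖) atTop (𝓝 0) := by
    refine (Measure.ae_prod_iff_ae_ae hmeas).2 ?_
    filter_upwards [h, Measure.ae_ae_of_ae_prod hmk] with x hx hmkx
    filter_upwards [hx, hmkx] with y hy hmky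
    exact hmky.1 hy
  filter_upwards [hmk, hlim] with z hmkz hz
  exact hmkz.2 hz

section Convolution

variable {E F : Type*} [NormedAddCommGroup E] [NormedSpace ℝ E] [HasContDiffBump E]
  [FiniteDimensional ℝ E] [MeasurableSpace E] [BorelSpace E] {μ : Measure E} [μ.IsAddHaarMeasure]
  [NormedAddCommGroup F] [NormedSpace ℝ F]

theorem norm_convolution_normed_le (b : ContDiffBump (0 : E)) {f : E → F} {M : ℝ} {x : E}
    (hM : ∀ᵐ y ∂μ.restrict (Metric.closedBall x b.rOut), ‖f y‖ ≤ M) :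
    ‖convolution (b.normed μ) f (ContinuousLinearMap.lsmul ℝ ℝ) μ x‖ ≤ M := by
  have hpoint : ∀ᵐ y ∂μ, ‖b.normed μ (x - y) • f y‖ ≤ b.normed μ (x - y) * M := by
    filter_upwards [(ae_restrict_iff' Metric.isClosed_closedBall.measurableSet).1 hM] with y hy
    rw [norm_smul, Real.norm_of_nonneg (b.nonneg_normed _)]
    by_cases hxy : y ∈ Metric.closedBall x b.rOut
    · exact mul_le_mul_of_nonneg_left (hy hxy) (b.nonneg_normed _)
    · have hzero : b.normed μ (x - y) = 0 := by
        rw [← Function.notMem_support, b.support_normed_eq, mem_ball_zero_iff, ← dist_eq_norm,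
          dist_comm]
        exact fun h => hxy h.le
      simp only [hzero, zero_mul, le_refl]
  rw [convolution_eq_swap]
  calc ‖∫ y, b.normed μ (x - y) • f y ∂μ‖
      ≤ ∫ y, b.normed μ (x - y) * M ∂μ :=
        norm_integral_le_of_norm_le ((b.integrable_normed.comp_sub_left x).mul_const M) hpoint
    _ = M := by
        rw [integral_mul_const, integral_sub_left_eq_self (fun y => b.normed μ y) μ x,
          b.integral_normed, one_mul]

theorem hasCompactSupport_compSubConst_mollifier (b : ContDiffBump (0 : E)) (x : E) :
    HasCompactSupport ((mollifier μ b).compSubConstCLM ℂ x) := by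
  refine HasCompactSupport.intro (isCompact_closedBall x b.rOut) fun y hy => ?_
  have hzero : b.normed μ (y - x) = 0 := by
    rw [← Function.notMem_support, b.support_normed_eq, mem_ball_zero_iff, ← dist_eq_norm]
    exact fun h => hy h.le
  rw [SchwartzMap.compSubConstCLM_apply, mollifier_apply, hzero, Complex.ofReal_zero]

end Convolution

section LocallyBounded

variable {d : ℕ} {T : ℝ} {g : ℝ → Rd d → Rd d}

theorem IsLocallyBounded.memLp_prod (hg : IsLocallyBounded T g) {K : Set (Rd d)}
    (hK : IsCompact K) : MemLp (Function.uncurry g) ∞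
      (((volume : Measure ℝ).restrict (Icc 0 T)).prod ((volume : Measure (Rd d)).restrict K)) := by
  rw [Measure.prod_restrict, ← Measure.volume_eq_prod]
  exact hg K hK

theorem IsLocallyBounded.exists_ae_norm_le (hg : IsLocallyBounded T g) {K : Set (Rd d)}
    (hK : IsCompact K) :
    ∃ M : ℝ, ∀ᵐ q ∂((volume : Measure ℝ).restrict (Icc 0 T)), ∀ᵐ x ∂(volume.restrict K),
      ‖g q x‖ ≤ M := by
  have hfinite := (hg.memLp_prod hK).eLpNorm_ne_top
  rw [eLpNorm_exponent_top] at hfinite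
  have hle : ∀ᵐ z ∂(((volume : Measure ℝ).restrict (Icc 0 T)).prod (volume.restrict K)),
      ‖g z.1 z.2‖ ≤ (eLpNormEssSup (Function.uncurry g) _).toReal :=
    ae_le_eLpNormEssSup.mono fun z hz =>
      (toReal_enorm (g z.1 z.2)).symm.trans_le (ENNReal.toReal_mono hfinite hz)
  exact ⟨_, Measure.ae_ae_of_ae_prod hle⟩

theorem IsLocallyBounded.ae_locallyIntegrable (hg : IsLocallyBounded T g) :
    ∀ᵐ q ∂((volume : Measure ℝ).restrict (Icc 0 T)), LocallyIntegrable (g q) volume := by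
  have hball (n : ℕ) : ∀ᵐ q ∂((volume : Measure ℝ).restrict (Icc 0 T)),
      IntegrableOn (g q) (Metric.closedBall 0 n) volume := by
    have hK := isCompact_closedBall (0 : Rd d) n
    have := isFiniteMeasure_restrict.2 (hK.measure_lt_top (μ := volume)).ne
    exact ((hg.memLp_prod hK).integrable le_top).prod_right_ae
  filter_upwards [ae_all_iff.2 hball] with q hq
  refine locallyIntegrable_iff.2 fun K hK => ?_
  obtain ⟨R, hR⟩ := hK.isBounded.subset_closedBall (0 : Rd d)
  obtain ⟨n, hn⟩ := exists_nat_ge R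
  exact (hq n).mono_set (hR.trans (Metric.closedBall_subset_closedBall hn))

theorem IsLocallyBounded.aestronglyMeasurable_uncurry (hg : IsLocallyBounded T g) :
    AEStronglyMeasurable (Function.uncurry g)
      (((volume : Measure ℝ).restrict (Icc 0 T)).prod (volume : Measure (Rd d))) := by
  rw [← Measure.restrict_univ (μ := (volume : Measure (Rd d))), Measure.prod_restrict,
    ← Metric.iUnion_closedBall_nat (0 : Rd d), prod_iUnion, aestronglyMeasurable_iUnion_iff]
  exact fun n => (hg _ (isCompact_closedBall 0 (n : ℝ))).1

variable {s : ℝ} {r : ℝ≥0∞} [Fact (1 ≤ r)] {u : C(Icc (0 : ℝ) T, SobolevVec d s r)}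

theorem IsGivenBy.ae_regularizeFun_eq_convolution (hu : IsGivenBy u g)
    (hg : IsLocallyBounded T g) :
    ∀ᵐ q ∂((volume : Measure ℝ).restrict (Icc 0 T)), ∀ (b : ContDiffBump (0 : Rd d)) R x,
      regularizeFun b R u q x = cutoff R x •
        convolution (b.normed volume) (g q) (ContinuousLinearMap.lsmul ℝ ℝ) volume x := by
  filter_upwards [ae_restrict_of_ae hu, hg.ae_locallyIntegrable,
    ae_restrict_mem measurableSet_Icc] with q hq hloc hqT b R x
  have h_int : Integrable (fun y => b.normed volume (x - y) • g q y) volume :=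
    (b.hasCompactSupport_normed.convolutionExists_left (ContinuousLinearMap.lsmul ℝ ℝ)
      b.continuous_normed hloc x).integrable_swap
  have hcoord (i : Fin d) :
      (∫ y, b.normed volume (x - y) • g q y) i = ∫ y, b.normed volume (x - y) * g q y i :=
    ((EuclideanSpace.proj (𝕜 := ℝ) i : Rd d →L[ℝ] ℝ).integral_comp_comm h_int).symm
  have hmollify (i : Fin d) :
      Sobolev.mollify b (u ⟨q, hqT⟩ i) x = ∫ y, b.normed volume (x - y) * g q y i := by
    rw [Sobolev.mollify, hq hqT i _ (hasCompactSupport_compSubConst_mollifier b x),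
      ← Complex.ofReal_re (∫ y, b.normed volume (x - y) * g q y i), ← integral_complex_ofReal]
    congr 2 with y
    rw [SchwartzMap.compSubConstCLM_apply, mollifier_apply, ← b.normed_neg (y - x), neg_sub,
      Complex.ofReal_mul]
  ext i
  rw [regularizeFun_apply b R u hqT, PiLp.smul_apply, smul_eq_mul, convolution_eq_swap, hmollify]
  exact congrArg _ (hcoord i).symm

theorem IsGivenBy.exists_ae_norm_regularizeFun_le (hu : IsGivenBy u g) (hg : IsLocallyBounded T g)
    (N : ℝ) : ∃ M : ℝ, ∀ᵐ q ∂((volume : Measure ℝ).restrict (Icc 0 T)),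
      ∀ b : ContDiffBump (0 : Rd d), b.rOut ≤ 1 → ∀ R x, ‖x‖ ≤ N →
        ‖regularizeFun b R u q x‖ ≤ M := by
  obtain ⟨M, hM⟩ := hg.exists_ae_norm_le (isCompact_closedBall 0 (N + 1))
  refine ⟨M, ?_⟩
  filter_upwards [hM, hu.ae_regularizeFun_eq_convolution hg] with q hq hreg b hb R x hx
  have hball : Metric.closedBall x b.rOut ⊆ Metric.closedBall 0 (N + 1) :=
    Metric.closedBall_subset_closedBall' (by rw [dist_zero_right]; linarith)
  rw [hreg, norm_smul, Real.norm_of_nonneg (cutoff_nonneg _ _)]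
  exact (mul_le_of_le_one_left (norm_nonneg _) (cutoff_le_one _ _)).trans
    (norm_convolution_normed_le b (ae_restrict_of_ae_restrict_of_subset hball hq))

theorem IsGivenBy.ae_tendsto_regularizeFun [Fact (r ≠ ∞)] (hu : IsGivenBy u g)
    (hg : IsLocallyBounded T g) {b : ℕ → ContDiffBump (0 : Rd d)} {K : ℝ}
    (hb : Tendsto (fun n => (b n).rOut) atTop (𝓝 0)) (hbK : ∀ n, (b n).rOut ≤ K * (b n).rIn)
    {R : ℕ → ℝ} (hR : Tendsto R atTop atTop) :
    ∀ᵐ z ∂((volume : Measure ℝ).restrict (Icc 0 T)).prod (volume : Measure (Rd d)),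
      Tendsto (fun n => regularizeFun (b n) (R n) u z.1 z.2) atTop (𝓝 (g z.1 z.2)) := by
  have hmeas (n : ℕ) : AEStronglyMeasurable (Function.uncurry (regularizeFun (b n) (R n) u))
      (((volume : Measure ℝ).restrict (Icc 0 T)).prod volume) := by
    rw [← Measure.restrict_univ (μ := (volume : Measure (Rd d))), Measure.prod_restrict]
    exact (continuousOn_uncurry_regularizeFun (b n) (R n) u).aestronglyMeasurable
      (measurableSet_Icc.prod MeasurableSet.univ)
  refine ae_prod_tendsto_of_ae_ae_tendsto hmeas hg.aestronglyMeasurable_uncurry ?_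
  filter_upwards [hg.ae_locallyIntegrable, hu.ae_regularizeFun_eq_convolution hg] with q hloc hreg
  filter_upwards [ContDiffBump.ae_convolution_tendsto_right_of_locallyIntegrable hb
    (Eventually.of_forall hbK) hloc] with x hx
  refine hx.congr' ?_
  filter_upwards [hR.eventually_ge_atTop ‖x‖] with n hn
  simp only [hreg, cutoff_eq_one hn, one_smul]

end LocallyBounded

/-! ### Passage to the limit -/

section BoundedConvergence

variable {E : Type*} [NormedAddCommGroup E] {f : ℕ → ℝ → E} {g : ℝ → E} {a b M : ℝ}

theorem intervalIntegrable_of_ae_tendsto_of_norm_le (hab : a ≤ b)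
    (hf : ∀ n, AEStronglyMeasurable (f n) (volume.restrict (Ioc a b)))
    (hM : ∀ᵐ q ∂volume.restrict (Ioc a b), ∀ n, ‖f n q‖ ≤ M)
    (hlim : ∀ᵐ q ∂volume.restrict (Ioc a b), Tendsto (f · q) atTop (𝓝 (g q))) :
    IntervalIntegrable g volume a b := by
  rw [intervalIntegrable_iff_integrableOn_Ioc_of_le hab]
  refine Integrable.of_bound (aestronglyMeasurable_of_tendsto_ae atTop hf hlim) M ?_
  filter_upwards [hM, hlim] with q hMq hlimq
  exact le_of_tendsto hlimq.norm (Eventually.of_forall hMq)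

theorem tendsto_intervalIntegral_of_ae_tendsto_of_norm_le [NormedSpace ℝ E] (hab : a ≤ b)
    (hf : ∀ n, AEStronglyMeasurable (f n) (volume.restrict (Ioc a b)))
    (hM : ∀ᵐ q ∂volume.restrict (Ioc a b), ∀ n, ‖f n q‖ ≤ M)
    (hlim : ∀ᵐ q ∂volume.restrict (Ioc a b), Tendsto (f · q) atTop (𝓝 (g q))) :
    Tendsto (fun n => ∫ q in a..b, f n q) atTop (𝓝 (∫ q in a..b, g q)) := by
  simp only [intervalIntegral.integral_of_le hab]
  exact tendsto_integral_of_dominated_convergence (fun _ => M) hf (integrable_const M)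
    (fun n => hM.mono fun q hq => hq n) hlim

end BoundedConvergence

section Limit

variable {Ω : Type*} [MeasurableSpace Ω] {P : Measure Ω} {d : ℕ} {W : ℝ≥0 → Ω → Rd d} {T : ℝ}
  {s : ℝ} {r : ℝ≥0∞} [Fact (1 ≤ r)] {u : C(Icc (0 : ℝ) T, SobolevVec d s r)}

theorem IsIntegralOperator.ae_eq_integral {l : ℝ → Rd d → Rd d}
    {A : C(Icc (0 : ℝ) T, SobolevVec d s r) → ContinuousProcess Ω T (Rd d)}
    (hA : IsIntegralOperator P W W A) (hW : IsBrownianVec W P)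
    (hl : IsContinuousCompactSupport T l) (hu : IsGivenBy u l) :
    ∀ᵐ ω ∂P, ∀ t ∈ Icc 0 T, (A u).val t ω = ∫ q in (0 : ℝ)..t, l q (W q.toNNReal ω) := by
  obtain ⟨C, hC, hext⟩ := hA.extension
  exact hW.integralAgainst_eq hC hl (hext l hl u hu)

variable [Fact (r ≠ ∞)] {g : ℝ → Rd d → Rd d} {R : ℕ → ℝ}

theorem IsBrownianVec.ae_tendsto_integral_regularizeFun [SFinite P] (hW : IsBrownianVec W P)
    (hT : 0 ≤ T) (hu : IsGivenBy u g) (hg : IsLocallyBounded T g) (hR : Tendsto R atTop atTop) :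
    ∀ᵐ ω ∂P, IntervalIntegrable (fun q => g q (W q.toNNReal ω)) volume 0 T ∧
      ∀ t ∈ Icc 0 T, Tendsto (fun n => ∫ q in (0 : ℝ)..t,
        regularizeFun (bumpSeq (Rd d) n) (R n) u q (W q.toNNReal ω)) atTop
        (𝓝 (∫ q in (0 : ℝ)..t, g q (W q.toNNReal ω))) := by
  have hconv := hu.ae_tendsto_regularizeFun hg (tendsto_bumpSeq_rOut (Rd d)) bumpSeq_rOut_le hR
  have hbound := hu.exists_ae_norm_regularizeFun_le hg
  simp only [← Measure.restrict_congr_set (Ioc_ae_eq_Icc (a := (0 : ℝ)) (b := T))] at hconv hbound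
  filter_upwards [hW.ae_continuous, hW.ae_ae_of_ae_prod hconv] with ω hWω hlim
  have hpath : Continuous fun q : ℝ => W q.toNNReal ω := hWω.comp continuous_real_toNNReal
  obtain ⟨N, hN⟩ := isCompact_Icc.exists_bound_of_continuousOn (s := Icc 0 T) hpath.continuousOn
  obtain ⟨M, hM⟩ := hbound N
  have hmeas (n : ℕ) : AEStronglyMeasurable
      (fun q => regularizeFun (bumpSeq (Rd d) n) (R n) u q (W q.toNNReal ω))
      (volume.restrict (Ioc 0 T)) :=
    (((isContinuousCompactSupport_regularizeFun _ (R n) u).continuousOn_path hWω).mono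
      Ioc_subset_Icc_self).aestronglyMeasurable measurableSet_Ioc
  have hle : ∀ᵐ q ∂(volume : Measure ℝ).restrict (Ioc 0 T), ∀ n,
      ‖regularizeFun (bumpSeq (Rd d) n) (R n) u q (W q.toNNReal ω)‖ ≤ M := by
    filter_upwards [hM, ae_restrict_mem measurableSet_Ioc] with q hq hqT n
    exact hq _ (bumpSeq_rOut_le_one n) _ _ (hN q (Ioc_subset_Icc_self hqT))
  refine ⟨intervalIntegrable_of_ae_tendsto_of_norm_le hT hmeas hle hlim, fun t ht => ?_⟩
  have hsub : Ioc 0 t ⊆ Ioc 0 T := Ioc_subset_Ioc_right ht.2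
  exact tendsto_intervalIntegral_of_ae_tendsto_of_norm_le ht.1
    (fun n => (hmeas n).mono_set hsub) (ae_restrict_of_ae_restrict_of_subset hsub hle)
    (ae_restrict_of_ae_restrict_of_subset hsub hlim)

end Limit

theorem mainTheorem7_general {Ω : Type*} [MeasurableSpace Ω] {P : Measure Ω}
    [IsProbabilityMeasure P] {d : ℕ} {T : ℝ} (hT : 0 ≤ T) {W : ℝ≥0 → Ω → Rd d}
    (hW : IsBrownianVec W P) {s : ℝ} (hs : s ≤ 0) {r : ℝ≥0∞} [Fact (1 ≤ r)] (hr : r < ∞)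
    {A : C(Icc (0 : ℝ) T, SobolevVec d s r) → ContinuousProcess Ω T (Rd d)}
    (hA : IsIntegralOperator P W W A) {g : ℝ → Rd d → Rd d} (hg : IsLocallyBounded T g)
    {u : C(Icc (0 : ℝ) T, SobolevVec d s r)} (hu : IsGivenBy u g) :
    ∀ᵐ ω ∂P, IntervalIntegrable (fun q => g q (W q.toNNReal ω)) volume 0 T ∧
      ∀ t ∈ Icc 0 T, (A u).val t ω = ∫ q in (0 : ℝ)..t, g q (W q.toNNReal ω) := by
  have : Fact (r ≠ ∞) := ⟨hr.ne⟩
  obtain ⟨R, hR, hconv⟩ := exists_tendsto_regularizeMap hs (tendsto_bumpSeq_rOut (Rd d)) u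
  have hucp : TendstoUCP P T
      (fun n => (A (regularizeMap hs (bumpSeq (Rd d) n) (R n) u)).val) atTop (A u).val :=
    fun η hη => (hA.continuity u η hη).comp hconv
  have hreg := ae_all_iff.2 fun n => hA.ae_eq_integral hW
    (isContinuousCompactSupport_regularizeFun (bumpSeq (Rd d) n) (R n) u)
    (isGivenBy_regularizeMap hs (bumpSeq (Rd d) n) (R n) u)
  have hpaths := hW.ae_tendsto_integral_regularizeFun hT hu hg hR
  have hcont : ∀ᵐ ω ∂P, ContinuousOn
      (fun t => ∫ q in (0 : ℝ)..t, g q (W q.toNNReal ω)) (Icc 0 T) := by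
    filter_upwards [hpaths] with ω hω
    rw [← uIcc_of_le hT]
    exact intervalIntegral.continuousOn_primitive_interval' hω.1 left_mem_uIcc
  refine (hpaths.mono fun ω hω => hω.1).and (hucp.ae_eq_of_forall_ae_tendsto
    (ae_of_all _ (A u).continuousOn) hcont fun t ht => ?_)
  filter_upwards [hreg, hpaths] with ω hregω hω
  simpa only [hregω _ t ht] using hω.2 t ht

theorem mainTheorem7 {Ω : Type*} [MeasurableSpace Ω] (P : Measure Ω) [IsProbabilityMeasure P]
    (d : ℕ) (T : ℝ) (hT : 0 < T) (W : ℝ≥0 → Ω → Rd d) (hW : IsBrownianVec W P)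
    (s : ℝ) (hs : -(1 / 2) < s) (hs' : s ≤ 0) (r : ℝ≥0∞) [Fact (1 ≤ r)] (hr : 2 ≤ r) (hr' : r < ∞)
    (A : C(Icc (0 : ℝ) T, SobolevVec d s r) → ContinuousProcess Ω T (Rd d))
    (hA : IsIntegralOperator P W W A)
    (g : ℝ → Rd d → Rd d) (hg : IsLocallyBounded T g)
    (u : C(Icc (0 : ℝ) T, SobolevVec d s r)) (hu : IsGivenBy u g) :
    ∀ᵐ ω ∂P, IntervalIntegrable (fun q => g q (W q.toNNReal ω)) volume 0 T ∧
      ∀ t ∈ Icc 0 T, (A u).val t ω = ∫ q in (0 : ℝ)..t, g q (W q.toNNReal ω) :=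
  mainTheorem7_general hT.le hW hs' hr' hA hg hu
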